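/- **Setting.** Let $n\ge 2$, $k\ge 1$ and $N$ be integers. Put $$D(n,2k)=\binom{n+k-1}{n-1}+\binom{n+k-2}{n-1},\qquad D(n,2k+1)=2\binom{n+k-1}{n-1}.$$ Let $P_0^{(n)}=1$, $P_1^{(n)}=t$, $(i+n-2)P_{i+1}^{(n)}=(2i+n-2)\,t\,P_i^{(n)}-i\,P_{i-1}^{(n)}$ $(i\ge 1)$ be the Gegenbauer polynomials, and for a real polynomial $f=\sum_i f_iP_i^{(n)}$ let $f_0$ be its zeroth Gegenbauer coefficient. A spherical $\tau$-design is a nonempty finite set $C\subset\mathbb S^{n-1}\subset\mathbb R^n$ over which the mean of every polynomial in $n$ variables of total degree at most $\tau$ equals its mean over $\mathbb S^{n-1}$ with respect to surface area. Let $$\mathcal L(n,N,\tau;h)=\inf_C\sum_{x,y\in C,\,x\ne y}h(\langle x,y\rangle),\qquad \ell(n,N,\tau)=\inf_C\ \min_{x,y\in C,\,x\ne y}\langle x,y\rangle ,$$ both infima being over the $\tau$-designs $C\subset\mathbb S^{n-1}$ with $|C|=N$. **Theorem.** Suppose that $D(n,2k)<N<D(n,2k+1)$, that a spherical $2k$-design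 of $N$ points exists on $\mathbb S^{n-1}$, and that $h$ is absolutely monotone on $[-1,1)$, that is, $h$ is infinitely differentiable there and $h^{(j)}(t)\ge0$ for all $j\ge 0$ and $t\in[-1,1)$ (in particular, $h$ may be absolutely monotone on $[-1,1]$). Then the following hold. 1. There are unique real numbers $-1=\beta_0<\beta_1<\dots<\beta_k<1$ and $\gamma_0,\dots,\gamma_k>0$ such that $$f_0=\frac{f(1)}N+\sum_{i=0}^k\gamma_i f(\beta_i)\qquad\text{for every real polynomial } f \text{ of degree at most } 2k .$$ 2. $\ell:=\ell(n,N,2k)>-1$. 3. There is a unique real polynomial $G$ of degree at most $2k$ with $$G(\ell)=h(\ell),\qquad G(\beta_i)=h(\beta_i),\quad G'(\beta_i)=h'(\beta_i)\quad (i=1,\dots,k).$$ 4. This $G$ satisfies $$\mathcal L(n,N,2k;h)\ \ge\ N\bigl(G_0N-G(1)\bigr)=N^2\sum_{i=0}^k\gamma_iG(\beta_i)\ \ge\ N^2\sum_{i=0}^k\gamma_ih(\beta_i),$$ and the last inequality is strict unless $h$ coincides on $[-1,1)$ with a polynomial of degree at most $2k$. -/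

import Mathlib

open scoped Polynomial

namespace DesignEnergy

noncomputable section

/-- The Delsarte-Goethals-Seidel bound `D(n, τ)`, for `n ≥ 1`: it is `2 * C(n+k-2, n-1)` for
`τ = 2k-1`, and `C(n+k-1, n-1) + C(n+k-2, n-1)` for `τ = 2k`. -/
def dgsBound (n τ : ℕ) : ℕ :=
  if Even τ then
    (n + τ / 2 - 1).choose (n - 1) + (n + τ / 2 - 2).choose (n - 1)
  else
    2 * (n + (τ + 1) / 2 - 2).choose (n - 1)

/-- The Gegenbauer polynomials `P_i^{(n)}`: `P_0 = 1`, `P_1 = t` and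
`(i+n-2) P_{i+1} = (2i+n-2) t P_i - i P_{i-1}` for `i ≥ 1` (below, `i` is replaced by `i+1`). -/
def gegenbauer (n : ℕ) : ℕ → ℝ[X]
  | 0 => 1
  | 1 => Polynomial.X
  | i + 2 =>
      Polynomial.C ((((i + 1 : ℕ) : ℝ) + n - 2)⁻¹) *
        (Polynomial.C (2 * ((i + 1 : ℕ) : ℝ) + n - 2) * Polynomial.X * gegenbauer n (i + 1)
          - Polynomial.C ((i + 1 : ℕ) : ℝ) * gegenbauer n i)

theorem gegenbauer_degree {n : ℕ} (hn : 2 ≤ n) (i : ℕ) : (gegenbauer n i).degree = i := by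
  have hn' : (2 : ℝ) ≤ n := by exact_mod_cast hn
  induction i using Nat.twoStepInduction with
  | zero => simp [gegenbauer]
  | one => simp [gegenbauer]
  | more i ih0 ih1 =>
    have hi : (0 : ℝ) ≤ i := Nat.cast_nonneg i
    have h1 : ((((i + 1 : ℕ) : ℝ) + n - 2)⁻¹) ≠ 0 := by
      apply inv_ne_zero
      push_cast
      linarith
    have h2 : (2 * ((i + 1 : ℕ) : ℝ) + n - 2) ≠ 0 := by
      push_cast
      linarith
    have hA : (Polynomial.C (2 * ((i + 1 : ℕ) : ℝ) + n - 2) * Polynomial.X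
        * gegenbauer n (i + 1)).degree = ((i + 2 : ℕ) : WithBot ℕ) := by
      rw [Polynomial.degree_mul, Polynomial.degree_mul, Polynomial.degree_C h2,
        Polynomial.degree_X, ih1]
      norm_cast
      omega
    have hB : (Polynomial.C ((i + 1 : ℕ) : ℝ) * gegenbauer n i).degree
        < (Polynomial.C (2 * ((i + 1 : ℕ) : ℝ) + n - 2) * Polynomial.X
        * gegenbauer n (i + 1)).degree := by
      have h3 : ((i + 1 : ℕ) : ℝ) ≠ 0 := by positivity
      rw [hA, Polynomial.degree_mul, Polynomial.degree_C h3, ih0]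
      norm_cast
      omega
    rw [gegenbauer, Polynomial.degree_mul, Polynomial.degree_C h1,
      Polynomial.degree_sub_eq_left_of_degree_lt hB, hA, zero_add]

/-- The basis `(P_i^{(n)})_{i ≥ 0}` of `ℝ[t]`, for `n ≥ 2`. -/
def gegenbauerBasis (n : ℕ) (hn : 2 ≤ n) : Module.Basis ℕ ℝ ℝ[X] :=
  Polynomial.Sequence.basis ⟨gegenbauer n, gegenbauer_degree hn⟩ fun i =>
    (Polynomial.leadingCoeff_ne_zero.mpr (Polynomial.Sequence.ne_zero _ i)).isUnit

theorem gegenbauerBasis_apply (n : ℕ) (hn : 2 ≤ n) (i : ℕ) :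
    gegenbauerBasis n hn i = gegenbauer n i := by
  unfold gegenbauerBasis
  rw [Polynomial.Sequence.basis_eq_self]

/-- The coefficient `f_i` in the Gegenbauer expansion `f = ∑ f_i P_i^{(n)}`. -/
def gegenbauerCoeff (n : ℕ) (hn : 2 ≤ n) (f : ℝ[X]) (i : ℕ) : ℝ :=
  (gegenbauerBasis n hn).repr f i

/-- `C` is a spherical `τ`-design: a nonempty finite subset of the unit sphere of `ℝⁿ` over which
the mean of each polynomial of total degree at most `τ` equals its mean over the sphere with
respect to the surface area measure. -/
structure IsDesign (n τ : ℕ) (C : Finset (EuclideanSpace ℝ (Fin n))) : Prop where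
  nonempty : C.Nonempty
  norm_eq_one : ∀ x ∈ C, ‖x‖ = 1
  mean_eq : ∀ f : MvPolynomial (Fin n) ℝ, f.totalDegree ≤ τ →
    (⨍ x : Metric.sphere (0 : EuclideanSpace ℝ (Fin n)) 1,
        MvPolynomial.eval (fun i => (x : EuclideanSpace ℝ (Fin n)) i) f
        ∂((MeasureTheory.volume : MeasureTheory.Measure (EuclideanSpace ℝ (Fin n))).toSphere))
      = (1 / (C.card : ℝ)) * ∑ x ∈ C, MvPolynomial.eval (fun i => x i) f

open Classical in
/-- The `h`-energy: the sum of `h ⟨x, y⟩` over the ordered pairs of distinct points of `C`. -/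
def energy (n : ℕ) (C : Finset (EuclideanSpace ℝ (Fin n))) (h : ℝ → ℝ) : ℝ :=
  ∑ p ∈ C.offDiag, h (inner ℝ p.1 p.2)

/-- `𝓛(n, N, τ; h)`: the infimum of the `h`-energy over the `τ`-designs of `N` points. -/
def minEnergy (n N τ : ℕ) (h : ℝ → ℝ) : ℝ :=
  sInf {e : ℝ | ∃ C : Finset (EuclideanSpace ℝ (Fin n)),
    IsDesign n τ C ∧ C.card = N ∧ e = energy n C h}

/-- `ℓ(C)`: the least inner product of two distinct points of `C` (the infimum of a finite set,
which is nonempty as soon as `C` has two points). -/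
def codeMinInner (n : ℕ) (C : Finset (EuclideanSpace ℝ (Fin n))) : ℝ :=
  sInf {t : ℝ | ∃ x ∈ C, ∃ y ∈ C, x ≠ y ∧ t = inner ℝ x y}

/-- `ℓ(n, N, τ)`: the infimum of `ℓ(C)` over the `τ`-designs `C` of `N` points. -/
def designMinInner (n N τ : ℕ) : ℝ :=
  sInf {t : ℝ | ∃ C : Finset (EuclideanSpace ℝ (Fin n)),
    IsDesign n τ C ∧ C.card = N ∧ t = codeMinInner n C}

/-- `β` and `γ` are the nodes and weights of Levenshtein's quadrature for `n`, `N`, `k`: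
`-1 = β_0 < β_1 < ⋯ < β_k < 1`, all `γ_i > 0`, and `f_0 = f(1)/N + ∑ γ_i f(β_i)` for all
polynomials `f` of degree at most `2k`. -/
structure IsLevenshteinQuadrature (n : ℕ) (hn : 2 ≤ n) (N k : ℕ)
    (β γ : Fin (k + 1) → ℝ) : Prop where
  node_zero : β 0 = -1
  strictMono : StrictMono β
  node_lt_one : ∀ i, β i < 1
  weight_pos : ∀ i, 0 < γ i
  exact_on : ∀ f : ℝ[X], f.natDegree ≤ 2 * k →
    gegenbauerCoeff n hn f 0 = f.eval 1 / N + ∑ i, γ i * f.eval (β i)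

/-- `G` is a polynomial of degree at most `2k` that agrees with `h` at `a` and agrees with `h` to
first order at `β_1, …, β_k`. -/
structure IsHermiteInterpolant (k : ℕ) (h : ℝ → ℝ) (a : ℝ) (β : Fin (k + 1) → ℝ)
    (G : ℝ[X]) : Prop where
  natDegree_le : G.natDegree ≤ 2 * k
  eval_left : G.eval a = h a
  eval_node : ∀ i : Fin k, G.eval (β i.succ) = h (β i.succ)
  deriv_node : ∀ i : Fin k, G.derivative.eval (β i.succ) = deriv h (β i.succ)

end

end DesignEnergy

/-! ### Moments of the surface measure along an axis, by Gaussian integrals. -/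

namespace DesignEnergy

open MeasureTheory Set

/-! Everything rests on the functional `L f = f_0 - f(1)/N`. The zeroth coefficient is the mean of
`f ⟨x, y⟩` over the sphere, for any unit vector `y` (`zonalMean_eq_zerothCoeff`). Hence, for a
`2k`-design of `N` points containing `y` and for `f` of degree at most `2k`, the sum of `f ⟨x, y⟩`
over the other points `x` is `N * L f` (`IsDesign.sum_erase_eval_inner`).

The lower bound on `N` makes `L` positive on squares of degree at most `2k`: the reproducing kernel
at `1` of the polynomials of degree at most `k` takes the value `D(n,2k)` there, and Cauchy-Schwarz
gives `q(1)^2 ≤ D(n,2k) (q^2)_0` (`eval_one_sq_le`). `L` is also positive on `(1 - t^2) q^2`, where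
the term at `1` vanishes. Such a functional has exactly one Gauss-Radau rule with fixed node `-1`.

The upper bound on `N` keeps inner products away from `-1`, uniformly over designs: testing with the
square of the kernel of one parity, whose values at `1` and `-1` are both large, leaves no room for
a nearly antipodal pair (`exists_neg_one_lt_forall_le_inner`). Conversely each design has an inner
product below `β_1` (`IsDesign.exists_inner_lt`), so `-1 < ℓ < β_1`.

By the Hermite error formula, `h - G` is a nonnegative derivative of `h` times `(t - ℓ) ∏ (t -
β_i)^2`, up to a positive factor. Thus `G ≤ h` on `[ℓ, 1)`, where all inner products lie, which
bounds the energy; and `G(-1) ≥ h(-1)`, which compares the two quadrature sums. Equality forces the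
derivative of order `2k+1` to vanish at an interior point, hence everywhere by absolute
monotonicity, so that `h = G`. -/

theorem hasFDerivAt_exp_neg_norm_sq {E : Type*} [NormedAddCommGroup E] [InnerProductSpace ℝ E]
    (x : E) :
    HasFDerivAt (fun x : E => Real.exp (-‖x‖ ^ 2))
      (-(Real.exp (-‖x‖ ^ 2) • (2 : ℕ) • (innerSL ℝ x : E →L[ℝ] ℝ))) x := by
  have := ((hasStrictFDerivAt_norm_sq x).hasFDerivAt.neg).exp
  simpa using this

section SphereMoments

variable {E : Type*} [NormedAddCommGroup E] [InnerProductSpace ℝ E] [FiniteDimensional ℝ E]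
  [MeasurableSpace E] [BorelSpace E] [Nontrivial E]

theorem integrable_inner_pow_mul_exp (μ : Measure E) [μ.IsAddHaarMeasure] (y : E) (j : ℕ) :
    Integrable (fun x : E => inner ℝ x y ^ j * Real.exp (-‖x‖ ^ 2)) μ := by
  have h1 : Integrable (fun x : E => (fun r : ℝ => ‖y‖ ^ j * (r ^ j * Real.exp (-r ^ 2))) ‖x‖) μ := by
    rw [integrable_fun_norm_addHaar μ
      (f := fun r : ℝ => ‖y‖ ^ j * (r ^ j * Real.exp (-r ^ 2)))]
    have := (integrableOn_rpow_mul_exp_neg_mul_sq (b := 1) one_pos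
      (s := ((j + (Module.finrank ℝ E - 1) : ℕ) : ℝ))
      (by have := Nat.cast_nonneg (α := ℝ) (j + (Module.finrank ℝ E - 1)); linarith)).const_mul
        (‖y‖ ^ j)
    refine this.congr (Filter.Eventually.of_forall fun r => ?_)
    simp only [Real.rpow_natCast, pow_add, smul_eq_mul, neg_mul, one_mul]
    ring
  refine h1.mono' (by fun_prop) (Filter.Eventually.of_forall fun x => ?_)
  change _ ≤ ‖y‖ ^ j * (‖x‖ ^ j * Real.exp (-‖x‖ ^ 2))
  rw [norm_mul, Real.norm_of_nonneg (Real.exp_pos _).le, norm_pow, ← mul_assoc, ← mul_pow]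
  have := norm_inner_le_norm (𝕜 := ℝ) x y
  gcongr
  linarith [mul_comm ‖x‖ ‖y‖]

/-- Polar coordinates: the power of the inner product is homogeneous of degree `j`, so the Gaussian
integral splits into a spherical and a radial factor. -/
theorem integral_inner_pow_mul_exp (μ : Measure E) [μ.IsAddHaarMeasure] (y : E) (j : ℕ) :
    ∫ x : E, inner ℝ x y ^ j * Real.exp (-‖x‖ ^ 2) ∂μ =
      (∫ θ : Metric.sphere (0 : E) 1, inner ℝ (θ : E) y ^ j ∂μ.toSphere) *
        ∫ r in Ioi (0 : ℝ), r ^ (j + (Module.finrank ℝ E - 1)) * Real.exp (-r ^ 2) := by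
  calc
    _ = ∫ x : ({(0)}ᶜ : Set E), inner ℝ (x : E) y ^ j * Real.exp (-‖(x : E)‖ ^ 2) ∂(μ.comap (↑)) := by
      rw [integral_subtype_comap (measurableSet_singleton _).compl
        fun x : E ↦ inner ℝ x y ^ j * Real.exp (-‖x‖ ^ 2), restrict_compl_singleton]
    _ = ∫ x : Metric.sphere (0 : E) 1 × Ioi (0 : ℝ), (fun θ : Metric.sphere (0 : E) 1 =>
          inner ℝ (θ : E) y ^ j) x.1 * (fun r : Ioi (0 : ℝ) =>
            (r : ℝ) ^ j * Real.exp (-(r : ℝ) ^ 2)) x.2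
          ∂μ.toSphere.prod (.volumeIoiPow (Module.finrank ℝ E - 1)) := by
      rw [← μ.measurePreserving_homeomorphUnitSphereProd.integral_comp
        (Homeomorph.measurableEmbedding _)]
      refine integral_congr_ae (Filter.Eventually.of_forall fun x => ?_)
      have hx : ‖(x : E)‖ ≠ 0 := norm_ne_zero_iff.2 x.2
      simp only [homeomorphUnitSphereProd_apply_fst_coe, homeomorphUnitSphereProd_apply_snd_coe,
        inner_smul_left, mul_pow, conj_trivial, inv_pow]
      field_simp
    _ = _ := by
      rw [integral_prod_mul (fun θ : Metric.sphere (0 : E) 1 => inner ℝ (θ : E) y ^ j)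
        (fun r : Ioi (0 : ℝ) => (r : ℝ) ^ j * Real.exp (-(r : ℝ) ^ 2))]
      congr 1
      rw [Measure.volumeIoiPow]
      simp only [ENNReal.ofReal]
      rw [integral_withDensity_eq_integral_smul (measurable_subtype_coe.pow_const _).real_toNNReal,
        integral_subtype_comap measurableSet_Ioi fun a : ℝ ↦
          Real.toNNReal (a ^ (Module.finrank ℝ E - 1)) • (a ^ j * Real.exp (-a ^ 2))]
      refine setIntegral_congr_fun measurableSet_Ioi fun x hx ↦ ?_
      simp only [NNReal.smul_def, Real.coe_toNNReal _ (pow_nonneg hx.out.le _), smul_eq_mul, pow_add]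
      ring

theorem integral_pow_mul_exp_pos (m : ℕ) :
    0 < ∫ r in Ioi (0 : ℝ), r ^ m * Real.exp (-r ^ 2) := by
  have h := integral_rpow_mul_exp_neg_rpow (p := 2) (q := m) two_pos
    (by have := Nat.cast_nonneg (α := ℝ) m; linarith)
  simp only [Real.rpow_natCast, Real.rpow_two] at h
  rw [h]
  have := Real.Gamma_pos_of_pos (s := ((m : ℝ) + 1) / 2) (by positivity)
  positivity

theorem integral_pow_add_two_mul_exp (m : ℕ) :
    ∫ r in Ioi (0 : ℝ), r ^ (m + 2) * Real.exp (-r ^ 2) =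
      (m + 1) / 2 * ∫ r in Ioi (0 : ℝ), r ^ m * Real.exp (-r ^ 2) := by
  have h := fun m : ℕ => integral_rpow_mul_exp_neg_rpow (p := 2) (q := m) two_pos
    (by have := Nat.cast_nonneg (α := ℝ) m; linarith)
  simp only [Real.rpow_natCast, Real.rpow_two] at h
  rw [h, h]
  have e : (((m + 2 : ℕ) : ℝ) + 1) / 2 = ((m : ℝ) + 1) / 2 + 1 := by push_cast; ring
  rw [e, Real.Gamma_add_one (by positivity)]
  ring

/-- Integration by parts in the direction `y`, along which the Gaussian has derivative `-2 ⟨x, y⟩`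
times itself. For `j = 0` the truncated exponent `j - 1` is harmless because of the factor `j`. -/
theorem integral_inner_pow_succ_mul_exp (μ : Measure E) [μ.IsAddHaarMeasure] (y : E)
    (hy : ‖y‖ = 1) (j : ℕ) :
    2 * ∫ x : E, inner ℝ x y ^ (j + 1) * Real.exp (-‖x‖ ^ 2) ∂μ =
      j * ∫ x : E, inner ℝ x y ^ (j - 1) * Real.exp (-‖x‖ ^ 2) ∂μ := by
  have hf : ∀ x : E, HasFDerivAt (fun x : E => inner ℝ x y ^ j)
      ((j * inner ℝ x y ^ (j - 1)) • (innerSL ℝ y)) x := by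
    intro x
    have h0 : HasFDerivAt (fun x : E => inner ℝ x y) (innerSL ℝ y) x := by
      have := (innerSL ℝ y).hasFDerivAt (x := x)
      refine this.congr_of_eventuallyEq (Filter.Eventually.of_forall fun z => ?_)
      simp [real_inner_comm]
    have := h0.pow j
    simpa [nsmul_eq_mul] using this
  have hg := fun x : E => hasFDerivAt_exp_neg_norm_sq x
  have e1 : ∀ x : E, (fderiv ℝ (fun x : E => inner ℝ x y ^ j) x) y * Real.exp (-‖x‖ ^ 2) =
      j * (inner ℝ x y ^ (j - 1) * Real.exp (-‖x‖ ^ 2)) := by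
    intro x
    rw [(hf x).fderiv]
    simp [hy]
    ring
  have e2 : ∀ x : E, inner ℝ x y ^ j * (fderiv ℝ (fun x : E => Real.exp (-‖x‖ ^ 2)) x) y =
      -2 * (inner ℝ x y ^ (j + 1) * Real.exp (-‖x‖ ^ 2)) := by
    intro x
    rw [(hg x).fderiv]
    simp
    ring
  have key := integral_mul_fderiv_eq_neg_fderiv_mul_of_integrable (μ := μ)
    (f := fun x : E => inner ℝ x y ^ j) (g := fun x : E => Real.exp (-‖x‖ ^ 2)) (v := y)
    (by simp_rw [e1]; exact (integrable_inner_pow_mul_exp μ y _).const_mul _)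
    (by simp_rw [e2]; exact (integrable_inner_pow_mul_exp μ y _).const_mul _)
    (integrable_inner_pow_mul_exp μ y j)
    (fun x _ => (hf x).differentiableAt) (fun x _ => (hg x).differentiableAt)
  simp_rw [e1, e2] at key
  rw [integral_const_mul, integral_const_mul] at key
  linarith

/-- The moments of the surface measure along an axis. -/
theorem integral_sphere_inner_eq_zero (μ : Measure E) [μ.IsAddHaarMeasure] (y : E)
    (hy : ‖y‖ = 1) :
    ∫ θ : Metric.sphere (0 : E) 1, inner ℝ (θ : E) y ∂μ.toSphere = 0 := by
  have h := integral_inner_pow_succ_mul_exp μ y hy 0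
  rw [integral_inner_pow_mul_exp] at h
  have := integral_pow_mul_exp_pos (0 + 1 + (Module.finrank ℝ E - 1))
  simpa [this.ne'] using h

/-- Divide the Gaussian recurrence by its radial factors; these differ by `(m + 1) / 2` with `m + 1
= j + dim E`. -/
theorem integral_sphere_inner_pow_add_two (μ : Measure E) [μ.IsAddHaarMeasure] (y : E)
    (hy : ‖y‖ = 1) (j : ℕ) :
    ((j : ℝ) + Module.finrank ℝ E) *
        ∫ θ : Metric.sphere (0 : E) 1, inner ℝ (θ : E) y ^ (j + 2) ∂μ.toSphere =
      (j + 1) * ∫ θ : Metric.sphere (0 : E) 1, inner ℝ (θ : E) y ^ j ∂μ.toSphere := by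
  have h := integral_inner_pow_succ_mul_exp μ y hy (j + 1)
  have hd : 1 ≤ Module.finrank ℝ E := Module.finrank_pos
  rw [integral_inner_pow_mul_exp, integral_inner_pow_mul_exp, Nat.add_sub_cancel,
    show j + 1 + 1 + (Module.finrank ℝ E - 1) = (j + (Module.finrank ℝ E - 1)) + 2 by ring,
    integral_pow_add_two_mul_exp] at h
  have hpos := integral_pow_mul_exp_pos (j + (Module.finrank ℝ E - 1))
  push_cast [Nat.cast_sub hd] at h
  refine mul_right_cancel₀ hpos.ne' ?_
  linear_combination h

end SphereMoments

end DesignEnergy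

/-! ### Gegenbauer identities and the characterization of the zeroth coefficient. -/

namespace DesignEnergy

open Polynomial

section Gegenbauer

variable {n : ℕ}

theorem gegenbauer_recurrence (hn : 2 ≤ n) (i : ℕ) :
    ((i : ℝ[X]) + (n : ℝ[X]) - 1) * gegenbauer n (i + 2) =
      (2 * (i : ℝ[X]) + (n : ℝ[X])) * X * gegenbauer n (i + 1) - ((i : ℝ[X]) + 1) * gegenbauer n i := by
  have hn' : (2 : ℝ) ≤ n := by exact_mod_cast hn
  have hi : (0 : ℝ) ≤ i := Nat.cast_nonneg i
  have h0 : (i : ℝ) + n - 1 ≠ 0 := by linarith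
  have h1 : ((i : ℝ[X]) + (n : ℝ[X]) - 1) = C ((i : ℝ) + n - 1) := by simp
  have h2 : (((i + 1 : ℕ) : ℝ) + n - 2) = (i : ℝ) + n - 1 := by push_cast; ring
  have h3 : (C (2 * ((i + 1 : ℕ) : ℝ) + n - 2) : ℝ[X]) = 2 * (i : ℝ[X]) + (n : ℝ[X]) := by
    have : (2 * ((i + 1 : ℕ) : ℝ) + n - 2) = 2 * i + n := by push_cast; ring
    rw [this]; simp only [C_add, C_mul, map_natCast, map_ofNat]
  rw [h1, gegenbauer, h2, h3, ← mul_assoc, ← C_mul, mul_inv_cancel₀ h0]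
  simp

theorem X_mul_gegenbauer (hn : 2 ≤ n) (i : ℕ) :
    (2 * (i : ℝ) + n) • (X * gegenbauer n (i + 1)) =
      ((i : ℝ) + n - 1) • gegenbauer n (i + 2) + ((i : ℝ) + 1) • gegenbauer n i := by
  have := gegenbauer_recurrence hn i
  simp only [smul_eq_C_mul, C_add, C_sub, C_mul, map_one, map_natCast, map_ofNat]
  linear_combination -this

theorem gegenbauer_natDegree (hn : 2 ≤ n) (i : ℕ) : (gegenbauer n i).natDegree = i :=
  natDegree_eq_of_degree_eq_some (gegenbauer_degree hn i)

theorem gegenbauer_eval_one (hn : 2 ≤ n) (i : ℕ) : (gegenbauer n i).eval 1 = 1 := by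
  have hn' : (2 : ℝ) ≤ n := by exact_mod_cast hn
  induction i using Nat.twoStepInduction with
  | zero => simp [gegenbauer]
  | one => simp [gegenbauer]
  | more i ih0 ih1 =>
    have h := congrArg (eval 1) (gegenbauer_recurrence hn i)
    have hi : (0 : ℝ) ≤ i := Nat.cast_nonneg i
    simp [ih0, ih1] at h
    refine mul_left_cancel₀ (a := (i : ℝ) + n - 1) (by linarith) ?_
    linarith

theorem gegenbauer_eval_neg_one (hn : 2 ≤ n) (i : ℕ) :
    (gegenbauer n i).eval (-1) = (-1) ^ i := by
  have hn' : (2 : ℝ) ≤ n := by exact_mod_cast hn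
  induction i using Nat.twoStepInduction with
  | zero => simp [gegenbauer]
  | one => simp [gegenbauer]
  | more i ih0 ih1 =>
    have h := congrArg (eval (-1)) (gegenbauer_recurrence hn i)
    have hi : (0 : ℝ) ≤ i := Nat.cast_nonneg i
    simp [ih0, ih1] at h
    refine mul_left_cancel₀ (a := (i : ℝ) + n - 1) (by linarith) ?_
    rw [h]
    ring

/-- The ladder identity lowering the degree. The induction differentiates the three-term recurrence
and multiplies it by `1 - X ^ 2`. -/
theorem gegenbauer_derivative (hn : 2 ≤ n) (i : ℕ) :
    (1 - X ^ 2) * derivative (gegenbauer n (i + 1)) =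
      ((i : ℝ[X]) + 1) * (gegenbauer n i - X * gegenbauer n (i + 1)) := by
  induction i using Nat.strong_induction_on with
  | _ i ih =>
    have hn' : (2 : ℝ) ≤ n := by exact_mod_cast hn
    have hne : ∀ j : ℕ, (j : ℝ[X]) + (n : ℝ[X]) - 1 ≠ 0 := by
      intro j
      have : (j : ℝ[X]) + (n : ℝ[X]) - 1 = C ((j : ℝ) + n - 1) := by simp
      have hj : (0 : ℝ) ≤ j := Nat.cast_nonneg j
      rw [this, C_ne_zero]
      linarith
    match i with
    | 0 => simp [gegenbauer]; ring
    | 1 =>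
      have h := gegenbauer_recurrence hn 0
      have hd := congrArg derivative h
      refine mul_left_cancel₀ (hne 0) ?_
      simp only [derivative_mul, derivative_sub, derivative_add, derivative_natCast, derivative_one,
        derivative_X, derivative_ofNat, derivative_zero, gegenbauer, Nat.cast_zero,
        Nat.cast_one] at h hd ⊢
      linear_combination (1 - X ^ 2) * hd + 2 * X * h
    | i + 2 =>
      have h1 := ih (i + 1) (by omega)
      have h0 := ih i (by omega)
      have hr0 := gegenbauer_recurrence hn i
      have hr1 := gegenbauer_recurrence hn (i + 1)
      have hd := congrArg derivative hr1
      refine mul_left_cancel₀ (hne (i + 1)) ?_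
      simp only [derivative_mul, derivative_sub, derivative_add, derivative_natCast, derivative_one,
        derivative_X, derivative_ofNat, Nat.cast_add, Nat.cast_one, Nat.cast_ofNat, add_assoc,
        Nat.reduceAdd] at h1 hr1 hd ⊢
      linear_combination (1 - X ^ 2) * hd + (2 * (i : ℝ[X]) + 2 + n) * X * h1
        - ((i : ℝ[X]) + 2) * h0 - ((i : ℝ[X]) + 2) * hr0 + ((i : ℝ[X]) + 3) * X * hr1

/-- The ladder identity raising the degree. -/
theorem gegenbauer_derivative' (hn : 2 ≤ n) (i : ℕ) :
    (1 - X ^ 2) * derivative (gegenbauer n (i + 1)) =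
      ((i : ℝ[X]) + (n : ℝ[X]) - 1) * (X * gegenbauer n (i + 1) - gegenbauer n (i + 2)) := by
  linear_combination gegenbauer_derivative hn i + gegenbauer_recurrence hn i

/-- The zeroth Gegenbauer coefficient, as a linear functional. -/
noncomputable def zerothCoeff (n : ℕ) (hn : 2 ≤ n) : ℝ[X] →ₗ[ℝ] ℝ :=
  (gegenbauerBasis n hn).coord 0

theorem gegenbauerCoeff_zero (hn : 2 ≤ n) (f : ℝ[X]) :
    gegenbauerCoeff n hn f 0 = zerothCoeff n hn f := rfl

theorem zerothCoeff_gegenbauer (hn : 2 ≤ n) (i : ℕ) :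
    zerothCoeff n hn (gegenbauer n i) = if i = 0 then 1 else 0 := by
  rw [zerothCoeff, ← gegenbauerBasis_apply n hn, Module.Basis.coord_apply, Module.Basis.repr_self,
    Finsupp.single_apply]

theorem linearMap_natCast_add_mul (φ : ℝ[X] →ₗ[ℝ] ℝ) (a b : ℕ) (f : ℝ[X]) :
    φ (((a : ℝ[X]) + (b : ℝ[X]) - 1) * f) = ((a : ℝ) + b - 1) * φ f := by
  have : ((a : ℝ[X]) + (b : ℝ[X]) - 1) * f = ((a : ℝ) + b - 1) • f := by
    rw [smul_eq_C_mul]; simp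
  rw [this, map_smul, smul_eq_mul]

/-- A functional satisfying the integration by parts identity of the weight
`(1 - t²) ^ ((n - 3) / 2)` is the zeroth Gegenbauer coefficient. -/
theorem eq_zerothCoeff (hn : 2 ≤ n) (φ : ℝ[X] →ₗ[ℝ] ℝ) (h1 : φ 1 = 1)
    (hφ : ∀ f : ℝ[X], φ ((1 - X ^ 2) * derivative f) = ((n : ℝ) - 1) * φ (X * f)) :
    φ = zerothCoeff n hn := by
  have hn' : (2 : ℝ) ≤ n := by exact_mod_cast hn
  have hlow : ∀ i : ℕ, ((n : ℝ) + i) * φ (X * gegenbauer n (i + 1)) =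
      (i + 1) * φ (gegenbauer n i) := by
    intro i
    have h := hφ (gegenbauer n (i + 1))
    have e : ((i : ℝ[X]) + 1) * (gegenbauer n i - X * gegenbauer n (i + 1)) =
        ((i : ℝ) + 1) • (gegenbauer n i - X * gegenbauer n (i + 1)) := by
      rw [smul_eq_C_mul]; simp
    rw [gegenbauer_derivative hn, e, map_smul, map_sub, smul_eq_mul] at h
    linarith
  have hraise : ∀ i : ℕ, ((i : ℝ) + n - 1) * φ (gegenbauer n (i + 2)) =
      i * φ (X * gegenbauer n (i + 1)) := by
    intro i
    have h := hφ (gegenbauer n (i + 1))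
    rw [gegenbauer_derivative' hn, linearMap_natCast_add_mul, map_sub] at h
    linarith
  -- Chaining `hlow` and `hraise` carries the vanishing from index `i + 1` to `i + 3`. Index 1 comes
  -- from the test function `1`, index 2 from the factor `i = 0` in `hraise`.
  have hz : ∀ i : ℕ, φ (gegenbauer n (i + 1)) = 0 := by
    intro i
    induction i using Nat.twoStepInduction with
    | zero =>
      have h := hφ 1
      simp only [derivative_one, mul_zero, map_zero, mul_one] at h
      rcases mul_eq_zero.1 h.symm with h | h
      · linarith
      · simpa [gegenbauer] using h
    | one =>
      have h := hraise 0
      simp only [Nat.cast_zero, zero_mul, zero_add] at h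
      rcases mul_eq_zero.1 h with h | h
      · linarith
      · exact h
    | more i ih _ =>
      have hi : (0 : ℝ) ≤ i := Nat.cast_nonneg i
      have hl := hlow (i + 1)
      have hr := hraise (i + 1)
      push_cast at hl hr
      rw [ih, mul_zero] at hl
      rcases mul_eq_zero.1 hl with h | h
      · linarith
      · rw [h, mul_zero] at hr
        rcases mul_eq_zero.1 hr with h | h
        · linarith
        · exact h
  refine (gegenbauerBasis n hn).ext fun i => ?_
  rw [gegenbauerBasis_apply, zerothCoeff_gegenbauer]
  cases i with
  | zero => simpa [gegenbauer] using h1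
  | succ i => simpa using hz i

/-- The zeroth Gegenbauer coefficient is determined by its moments. -/
theorem eq_zerothCoeff_of_moments (hn : 2 ≤ n) (φ : ℝ[X] →ₗ[ℝ] ℝ) (h0 : φ 1 = 1)
    (h1 : φ X = 0) (h2 : ∀ j : ℕ, ((j : ℝ) + n) * φ (X ^ (j + 2)) = (j + 1) * φ (X ^ j)) :
    φ = zerothCoeff n hn := by
  refine eq_zerothCoeff hn φ h0 fun f => ?_
  induction f using Polynomial.induction_on' with
  | add p q hp hq => rw [derivative_add, mul_add, mul_add, map_add, map_add, hp, hq]; ring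
  | monomial j a =>
    cases j with
    | zero =>
      have : (X * (monomial 0) a : ℝ[X]) = a • X := by
        rw [smul_eq_C_mul, monomial_zero_left]; ring
      rw [this, map_smul, h1, monomial_zero_left, derivative_C]
      simp
    | succ j =>
      have e1 : (1 - X ^ 2) * derivative ((monomial (j + 1)) a) =
          (a * (j + 1)) • (X ^ j - X ^ (j + 2) : ℝ[X]) := by
        rw [derivative_monomial, smul_eq_C_mul, ← C_mul_X_pow_eq_monomial]
        simp only [Nat.add_sub_cancel, Nat.cast_add, Nat.cast_one]
        ring
      have e2 : X * (monomial (j + 1)) a = a • (X ^ (j + 2) : ℝ[X]) := by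
        rw [smul_eq_C_mul, ← C_mul_X_pow_eq_monomial]
        ring
      rw [e1, e2, map_smul, map_smul, map_sub, smul_eq_mul, smul_eq_mul]
      linear_combination (-a) * h2 j

end Gegenbauer

end DesignEnergy

/-! ### Orthogonality, norms and reproducing kernels. -/

namespace DesignEnergy

open Polynomial

section Kernel

variable {n : ℕ}

/-- The recurrence moves a factor `X` from the polynomial of smaller index to the other one, which
lowers the smaller index. -/
theorem zerothCoeff_gegenbauer_mul_of_lt (hn : 2 ≤ n) :
    ∀ i j : ℕ, i < j → zerothCoeff n hn (gegenbauer n i * gegenbauer n j) = 0 := by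
  have hn' : (2 : ℝ) ≤ n := by exact_mod_cast hn
  intro i
  induction i using Nat.twoStepInduction with
  | zero =>
    intro j hj
    rw [gegenbauer, one_mul, zerothCoeff_gegenbauer, if_neg (by omega)]
  | one =>
    intro j hj
    obtain ⟨m, rfl⟩ : ∃ m, j = m + 2 := ⟨j - 2, by omega⟩
    have h := congrArg (zerothCoeff n hn) (X_mul_gegenbauer hn (m + 1))
    rw [map_smul, map_add, map_smul, map_smul, zerothCoeff_gegenbauer, zerothCoeff_gegenbauer,
      if_neg (by omega), if_neg (by omega)] at h
    simp only [smul_eq_mul, mul_zero, add_zero] at h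
    have hm : (0 : ℝ) ≤ ((m + 1 : ℕ) : ℝ) := Nat.cast_nonneg _
    exact (mul_eq_zero.1 h).resolve_left (by linarith)
  | more i ih0 ih1 =>
    intro j hj
    obtain ⟨m, rfl⟩ : ∃ m, j = m + 1 := ⟨j - 1, by omega⟩
    have hi : (0 : ℝ) ≤ i := Nat.cast_nonneg i
    have hm : (0 : ℝ) ≤ m := Nat.cast_nonneg m
    have h1 : zerothCoeff n hn (X * gegenbauer n (i + 1) * gegenbauer n (m + 1)) = 0 := by
      have e : (2 * (m : ℝ) + n) • (X * gegenbauer n (i + 1) * gegenbauer n (m + 1)) =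
          ((m : ℝ) + n - 1) • (gegenbauer n (i + 1) * gegenbauer n (m + 2)) +
            ((m : ℝ) + 1) • (gegenbauer n (i + 1) * gegenbauer n m) := by
        have := X_mul_gegenbauer hn m
        simp only [smul_eq_C_mul] at this ⊢
        linear_combination gegenbauer n (i + 1) * this
      have h := congrArg (zerothCoeff n hn) e
      rw [map_smul, map_add, map_smul, map_smul, ih1 _ (by omega), ih1 _ (by omega)] at h
      simp only [smul_eq_mul, mul_zero, add_zero] at h
      exact (mul_eq_zero.1 h).resolve_left (by linarith)
    have e : ((i : ℝ) + n - 1) • (gegenbauer n (i + 2) * gegenbauer n (m + 1)) =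
        (2 * (i : ℝ) + n) • (X * gegenbauer n (i + 1) * gegenbauer n (m + 1)) -
          ((i : ℝ) + 1) • (gegenbauer n i * gegenbauer n (m + 1)) := by
      have := X_mul_gegenbauer hn i
      simp only [smul_eq_C_mul] at this ⊢
      linear_combination (-gegenbauer n (m + 1)) * this
    have h := congrArg (zerothCoeff n hn) e
    rw [map_smul, map_sub, map_smul, map_smul, h1, ih0 _ (by omega)] at h
    simp only [smul_eq_mul, mul_zero, sub_zero] at h
    exact (mul_eq_zero.1 h).resolve_left (by linarith)

theorem zerothCoeff_gegenbauer_mul_of_ne (hn : 2 ≤ n) {i j : ℕ} (h : i ≠ j) :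
    zerothCoeff n hn (gegenbauer n i * gegenbauer n j) = 0 := by
  rcases h.lt_or_gt with h | h
  · exact zerothCoeff_gegenbauer_mul_of_lt hn i j h
  · rw [mul_comm]
    exact zerothCoeff_gegenbauer_mul_of_lt hn j i h

theorem zerothCoeff_gegenbauer_one_sq (hn : 2 ≤ n) :
    n * zerothCoeff n hn (gegenbauer n 1 * gegenbauer n 1) = 1 := by
  have h := congrArg (zerothCoeff n hn) (X_mul_gegenbauer hn 0)
  have h0 := zerothCoeff_gegenbauer hn 0
  have h2 := zerothCoeff_gegenbauer hn 2
  rw [map_smul, map_add, map_smul, map_smul, zero_add, zero_add, h0, h2] at h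
  simpa [gegenbauer] using h

/-- Expand `X * P_{i+1} * P_{i+2}` by the recurrence for either factor; orthogonality leaves one
square on each side. -/
theorem zerothCoeff_gegenbauer_sq_succ (hn : 2 ≤ n) (i : ℕ) :
    (2 * (i : ℝ) + n + 2) * ((i : ℝ) + n - 1) *
        zerothCoeff n hn (gegenbauer n (i + 2) * gegenbauer n (i + 2)) =
      (2 * (i : ℝ) + n) * ((i : ℝ) + 2) *
        zerothCoeff n hn (gegenbauer n (i + 1) * gegenbauer n (i + 1)) := by
  have e1 : ((i : ℝ) + n - 1) • (gegenbauer n (i + 2) * gegenbauer n (i + 2)) =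
      (2 * (i : ℝ) + n) • (X * gegenbauer n (i + 1) * gegenbauer n (i + 2)) -
        ((i : ℝ) + 1) • (gegenbauer n i * gegenbauer n (i + 2)) := by
    have := X_mul_gegenbauer hn i
    simp only [smul_eq_C_mul] at this ⊢
    linear_combination (-gegenbauer n (i + 2)) * this
  have e2 : (2 * ((i + 1 : ℕ) : ℝ) + n) • (X * gegenbauer n (i + 1) * gegenbauer n (i + 2)) =
      (((i + 1 : ℕ) : ℝ) + n - 1) • (gegenbauer n (i + 1) * gegenbauer n (i + 3)) +
        (((i + 1 : ℕ) : ℝ) + 1) • (gegenbauer n (i + 1) * gegenbauer n (i + 1)) := by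
    have := X_mul_gegenbauer hn (i + 1)
    simp only [smul_eq_C_mul] at this ⊢
    linear_combination (gegenbauer n (i + 1)) * this
  have h1 := congrArg (zerothCoeff n hn) e1
  have h2 := congrArg (zerothCoeff n hn) e2
  rw [map_smul, map_sub, map_smul, map_smul,
    zerothCoeff_gegenbauer_mul_of_ne hn (show i ≠ i + 2 by omega)] at h1
  rw [map_smul, map_add, map_smul, map_smul,
    zerothCoeff_gegenbauer_mul_of_ne hn (show i + 1 ≠ i + 3 by omega)] at h2
  simp only [smul_eq_mul] at h1 h2
  push_cast at h2
  linear_combination (2 * (i : ℝ) + n + 2) * h1 + (2 * (i : ℝ) + n) * h2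

/-- The dimension of the homogeneous polynomials of degree `k` in `n` variables. -/
noncomputable def homDim (n k : ℕ) : ℝ := ((n + k - 1).choose (n - 1) : ℕ)

/-- The dimension of the harmonic polynomials of degree `i` in `n` variables. -/
noncomputable def harmDim (n : ℕ) : ℕ → ℝ
  | 0 => 1
  | 1 => n
  | i + 2 => homDim n (i + 2) - homDim n i

theorem homDim_zero (n : ℕ) : homDim n 0 = 1 := by simp [homDim]

theorem homDim_one (hn : 2 ≤ n) : homDim n 1 = n := by
  obtain ⟨m, rfl⟩ : ∃ m, n = m + 1 := ⟨n - 1, by omega⟩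
  simp [homDim]

theorem homDim_succ (hn : 2 ≤ n) (k : ℕ) :
    ((k : ℝ) + 1) * homDim n (k + 1) = ((n : ℝ) + k) * homDim n k := by
  obtain ⟨m, rfl⟩ : ∃ m, n = m + 1 := ⟨n - 1, by omega⟩
  have h := Nat.add_one_mul_choose_eq (m + k) k
  have e1 : (m + k).choose k = (m + k).choose m := Nat.choose_symm_add.symm
  have e2 : (m + k + 1).choose (k + 1) = (m + (k + 1)).choose m :=
    (Nat.choose_symm_add (a := m) (b := k + 1)).symm
  rw [e1, e2] at h
  have h' := congrArg (Nat.cast (R := ℝ)) h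
  simp only [homDim, Nat.add_sub_cancel, show m + 1 + (k + 1) - 1 = m + (k + 1) by omega,
    show m + 1 + k - 1 = m + k by omega]
  push_cast at h' ⊢
  linarith

theorem homDim_pos (hn : 2 ≤ n) (k : ℕ) : 0 < homDim n k := by
  rw [homDim, Nat.cast_pos]
  exact Nat.choose_pos (by omega)

theorem harmDim_add_two (hn : 2 ≤ n) (i : ℕ) :
    harmDim n (i + 2) * ((i + 2) * (i + 1)) = homDim n i * ((n - 1) * (n + 2 * i + 2)) := by
  have h1 := homDim_succ hn i
  have h2 := homDim_succ hn (i + 1)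
  push_cast at h2
  rw [harmDim]
  linear_combination ((i : ℝ) + 1) * h2 + ((n : ℝ) + i + 1) * h1

/-- The squared norms and the reciprocals of the dimensions obey the same first-order recurrence;
`hr` is the one for the dimensions. -/
theorem harmDim_mul (hn : 2 ≤ n) (i : ℕ) :
    harmDim n i * zerothCoeff n hn (gegenbauer n i * gegenbauer n i) = 1 := by
  have hn' : (2 : ℝ) ≤ n := by exact_mod_cast hn
  cases i with
  | zero =>
    have h := zerothCoeff_gegenbauer hn 0
    simpa [harmDim, gegenbauer] using h
  | succ i =>
    induction i with
    | zero => simpa [harmDim] using zerothCoeff_gegenbauer_one_sq hn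
    | succ i ih =>
      have h := zerothCoeff_gegenbauer_sq_succ hn i
      have hi : (0 : ℝ) ≤ i := Nat.cast_nonneg i
      have hr : harmDim n (i + 2) * ((i + 2) * (n + 2 * i)) =
          harmDim n (i + 1) * ((i + n - 1) * (n + 2 * i + 2)) := by
        have h2 := harmDim_add_two hn i
        have h1 : harmDim n (i + 1) * ((n + i - 1) * (i + 1)) =
            homDim n i * ((n - 1) * (n + 2 * i)) := by
          cases i with
          | zero => simp [harmDim, homDim_zero n]; ring
          | succ i =>
            have h3 := harmDim_add_two hn i
            have h4 := homDim_succ hn i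
            have hi : (0 : ℝ) ≤ i := Nat.cast_nonneg i
            push_cast
            refine mul_left_cancel₀ (a := (i : ℝ) + 1) (by linarith) ?_
            linear_combination (n + i : ℝ) * h3 - ((n : ℝ) - 1) * (n + 2 * i + 2) * h4
        refine mul_left_cancel₀ (a := (i : ℝ) + 1) (by linarith) ?_
        linear_combination (n + 2 * i : ℝ) * h2 - (n + 2 * i + 2 : ℝ) * h1
      have hpos : (0 : ℝ) < (2 * i + n + 2) * (i + n - 1) := by
        apply mul_pos <;> linarith
      refine mul_left_cancel₀ hpos.ne' ?_
      rw [mul_one]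
      have hpos2 : (0 : ℝ) < (i + 2) * (n + 2 * i) := by positivity
      refine mul_left_cancel₀ hpos2.ne' ?_
      linear_combination ((i : ℝ) + 2) * (n + 2 * i) * harmDim n (i + 2) * h
        + (2 * (i : ℝ) + n) * ((i : ℝ) + 2) *
            zerothCoeff n hn (gegenbauer n (i + 1) * gegenbauer n (i + 1)) * hr
        + (2 * (i : ℝ) + n) * ((i : ℝ) + 2) * ((i + n - 1) * (n + 2 * i + 2)) * ih

/-- The reproducing kernel of the polynomials of degree at most `k` with the parity of `k`,
with one argument equal to `1`. -/
noncomputable def parityKernel (n : ℕ) : ℕ → ℝ[X]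
  | 0 => 1
  | 1 => C (n : ℝ) * X
  | k + 2 => parityKernel n k + C (harmDim n (k + 2)) * gegenbauer n (k + 2)

theorem parityKernel_eval_one (hn : 2 ≤ n) (k : ℕ) : (parityKernel n k).eval 1 = homDim n k := by
  induction k using Nat.twoStepInduction with
  | zero => simp [parityKernel, homDim_zero n]
  | one => simp [parityKernel, homDim_one hn]
  | more k ih _ => simp [parityKernel, ih, gegenbauer_eval_one hn, harmDim]

theorem parityKernel_eval_neg_one (hn : 2 ≤ n) (k : ℕ) :
    (parityKernel n k).eval (-1) = (-1) ^ k * homDim n k := by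
  induction k using Nat.twoStepInduction with
  | zero => simp [parityKernel, homDim_zero n]
  | one => simp [parityKernel, homDim_one hn]
  | more k ih _ => simp [parityKernel, ih, gegenbauer_eval_neg_one hn, harmDim]; ring

theorem parityKernel_natDegree_le (hn : 2 ≤ n) (k : ℕ) : (parityKernel n k).natDegree ≤ k := by
  induction k using Nat.twoStepInduction with
  | zero => simp [parityKernel]
  | one => exact (natDegree_C_mul_le _ _).trans (by simp)
  | more k ih _ =>
    refine natDegree_add_le_of_degree_le (ih.trans (by omega)) ?_
    exact (natDegree_C_mul_le _ _).trans (gegenbauer_natDegree hn _).le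

theorem zerothCoeff_parityKernel_mul_of_lt (hn : 2 ≤ n) (k : ℕ) :
    ∀ j, k < j → zerothCoeff n hn (parityKernel n k * gegenbauer n j) = 0 := by
  induction k using Nat.twoStepInduction with
  | zero =>
    intro j hj
    rw [parityKernel, one_mul, zerothCoeff_gegenbauer, if_neg (by omega)]
  | one =>
    intro j hj
    have := zerothCoeff_gegenbauer_mul_of_lt hn 1 j hj
    rw [gegenbauer] at this
    rw [parityKernel, mul_assoc, ← smul_eq_C_mul, map_smul, this, smul_zero]
  | more k ih _ =>
    intro j hj
    rw [parityKernel, add_mul, map_add, ih j (by omega), mul_assoc, ← smul_eq_C_mul, map_smul,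
      zerothCoeff_gegenbauer_mul_of_lt hn _ j hj, smul_zero, add_zero]

/-- The index `k + 1` is admitted because both sides vanish there, by orthogonality and by parity.
This lets two consecutive kernels be added and still reproduce up to degree `k + 1`. -/
theorem zerothCoeff_parityKernel_mul_gegenbauer (hn : 2 ≤ n) (k : ℕ) :
    ∀ j, j ≤ k + 1 →
      zerothCoeff n hn (parityKernel n k * gegenbauer n j) = (1 + (-1) ^ k * (-1) ^ j) / 2 := by
  induction k using Nat.twoStepInduction with
  | zero =>
    intro j hj
    rw [parityKernel, one_mul, zerothCoeff_gegenbauer]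
    interval_cases j <;> simp
  | one =>
    intro j hj
    rw [parityKernel, mul_assoc, ← smul_eq_C_mul, map_smul]
    have h := fun j => harmDim_mul hn j
    have h' := fun j (hj : 1 ≠ j) => zerothCoeff_gegenbauer_mul_of_ne hn hj
    interval_cases j
    · have := h' 0 (by omega)
      simp only [gegenbauer, mul_one] at this
      simp [gegenbauer, this]
    · have := h 1
      simp only [gegenbauer, harmDim] at this
      simp [gegenbauer, this]
    · have := h' 2 (by omega)
      rw [show gegenbauer n 1 = X from rfl] at this
      simp [this]
  | more k ih _ =>
    intro j hj
    rw [parityKernel, add_mul, map_add, mul_assoc, ← smul_eq_C_mul, map_smul, smul_eq_mul]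
    rcases Nat.lt_or_ge j (k + 2) with h | h
    · rw [ih j (by omega), zerothCoeff_gegenbauer_mul_of_ne hn (by omega)]
      ring
    · rw [zerothCoeff_parityKernel_mul_of_lt hn k j (by omega)]
      obtain rfl | rfl : j = k + 2 ∨ j = k + 3 := by omega
      · rw [harmDim_mul, ← mul_pow]
        norm_num
      · rw [zerothCoeff_gegenbauer_mul_of_ne hn (by omega)]
        rw [show k + 3 = (k + 2) + 1 from rfl, pow_succ (-1 : ℝ) (k + 2), ← mul_assoc, ← mul_pow]
        norm_num

theorem mem_span_gegenbauer (hn : 2 ≤ n) {m : ℕ} {f : ℝ[X]} (hf : f.natDegree ≤ m) :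
    f ∈ Submodule.span ℝ (gegenbauer n '' Set.Iic m) := by
  have h := (Polynomial.Sequence.mk (gegenbauer n) (gegenbauer_degree hn)).span_degreeLE (m := m)
    (fun i _ => (Polynomial.leadingCoeff_ne_zero.mpr (Polynomial.Sequence.ne_zero _ i)).isUnit)
  change Submodule.span ℝ (gegenbauer n '' Set.Iic m) = _ at h
  rw [h, mem_degreeLE]
  exact natDegree_le_iff_degree_le.1 hf

theorem zerothCoeff_parityKernel_mul (hn : 2 ≤ n) (k : ℕ) {f : ℝ[X]} (hf : f.natDegree ≤ k + 1) :
    zerothCoeff n hn (parityKernel n k * f) = (f.eval 1 + (-1) ^ k * f.eval (-1)) / 2 := by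
  have hs := mem_span_gegenbauer hn hf
  clear hf
  induction hs using Submodule.span_induction with
  | mem x hx =>
    obtain ⟨j, hj, rfl⟩ := hx
    rw [zerothCoeff_parityKernel_mul_gegenbauer hn k j hj, gegenbauer_eval_one hn,
      gegenbauer_eval_neg_one hn]
  | zero => simp
  | add x y _ _ hx hy => rw [mul_add, map_add, hx, hy, eval_add, eval_add]; ring
  | smul a x _ hx => rw [mul_smul_comm, map_smul, hx, eval_smul, eval_smul]; simp; ring

/-- The reproducing kernel property at `1` of `parityKernel n (k + 1) + parityKernel n k`. -/
theorem zerothCoeff_kernel_mul (hn : 2 ≤ n) (k : ℕ) {f : ℝ[X]} (hf : f.natDegree ≤ k + 1) :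
    zerothCoeff n hn ((parityKernel n (k + 1) + parityKernel n k) * f) = f.eval 1 := by
  rw [add_mul, map_add, zerothCoeff_parityKernel_mul hn k hf,
    zerothCoeff_parityKernel_mul hn (k + 1) (hf.trans (by omega))]
  ring

theorem zerothCoeff_parityKernel_sq (hn : 2 ≤ n) (k : ℕ) :
    zerothCoeff n hn (parityKernel n k ^ 2) = homDim n k := by
  rw [sq, zerothCoeff_parityKernel_mul hn k ((parityKernel_natDegree_le hn k).trans (by omega)),
    parityKernel_eval_one hn, parityKernel_eval_neg_one hn, ← mul_assoc, ← mul_pow]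
  norm_num

theorem dgsBound_even (hn : 2 ≤ n) (k : ℕ) :
    (dgsBound n (2 * (k + 1)) : ℝ) = homDim n (k + 1) + homDim n k := by
  rw [dgsBound, if_pos (even_two_mul _), homDim, homDim]
  rw [show 2 * (k + 1) / 2 = k + 1 by omega, show n + (k + 1) - 2 = n + k - 1 by omega]
  push_cast
  rfl

theorem dgsBound_odd (hn : 2 ≤ n) (k : ℕ) :
    (dgsBound n (2 * k + 1) : ℝ) = 2 * homDim n k := by
  rw [dgsBound, if_neg (by simp), homDim, show (2 * k + 1 + 1) / 2 = k + 1 by omega,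
    show n + (k + 1) - 2 = n + k - 1 by omega]
  push_cast
  rfl

end Kernel

end DesignEnergy

/-! ### Means over the sphere and over designs. -/

namespace DesignEnergy

open MeasureTheory Polynomial

section SphereMean

variable {n : ℕ}

theorem integrable_sphere_eval_inner (y : EuclideanSpace ℝ (Fin n)) (f : ℝ[X]) :
    Integrable (fun θ : Metric.sphere (0 : EuclideanSpace ℝ (Fin n)) 1 =>
      f.eval (inner ℝ (θ : EuclideanSpace ℝ (Fin n)) y))
      (volume : Measure (EuclideanSpace ℝ (Fin n))).toSphere :=
  (f.continuous.comp (by fun_prop)).integrable_of_hasCompactSupport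
    (HasCompactSupport.of_compactSpace _)

/-- The mean over the unit sphere of a zonal polynomial with axis `y`, as a linear functional. -/
noncomputable def zonalMean (y : EuclideanSpace ℝ (Fin n)) : ℝ[X] →ₗ[ℝ] ℝ where
  toFun f := ⨍ θ : Metric.sphere (0 : EuclideanSpace ℝ (Fin n)) 1,
    f.eval (inner ℝ (θ : EuclideanSpace ℝ (Fin n)) y)
    ∂((volume : Measure (EuclideanSpace ℝ (Fin n))).toSphere)
  map_add' f g := by
    simp only [average_eq, eval_add]
    rw [integral_add (integrable_sphere_eval_inner y f) (integrable_sphere_eval_inner y g),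
      smul_add]
  map_smul' a f := by
    simp only [average_eq, eval_smul, RingHom.id_apply]
    rw [integral_smul, smul_comm]

theorem zonalMean_eq_zerothCoeff (hn : 2 ≤ n) (y : EuclideanSpace ℝ (Fin n)) (hy : ‖y‖ = 1) :
    zonalMean y = zerothCoeff n hn := by
  have : Nonempty (Fin n) := ⟨⟨0, by omega⟩⟩
  have : Nontrivial (EuclideanSpace ℝ (Fin n)) :=
    ⟨⟨y, 0, by rintro rfl; simp at hy⟩⟩
  refine eq_zerothCoeff_of_moments hn _ ?_ ?_ fun j => ?_
  · simp only [zonalMean, LinearMap.coe_mk, AddHom.coe_mk, eval_one]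
    have : NeZero (volume : Measure (EuclideanSpace ℝ (Fin n))).toSphere :=
      ⟨Measure.toSphere_ne_zero _⟩
    exact average_const _ _
  · simp only [zonalMean, LinearMap.coe_mk, AddHom.coe_mk, eval_X, average_eq]
    rw [integral_sphere_inner_eq_zero _ y hy, smul_zero]
  · have h := integral_sphere_inner_pow_add_two volume y hy j
    rw [finrank_euclideanSpace_fin] at h
    simp only [zonalMean, LinearMap.coe_mk, AddHom.coe_mk, eval_pow, eval_X, average_eq,
      smul_eq_mul]
    linear_combination ((volume : Measure (EuclideanSpace ℝ (Fin n))).toSphere.real Set.univ)⁻¹ * h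

/-- The zeroth Gegenbauer coefficient is a positive functional on `[-1, 1]`. -/
theorem zerothCoeff_pos (hn : 2 ≤ n) {f : ℝ[X]} (hf : f ≠ 0)
    (hpos : ∀ t ∈ Set.Icc (-1 : ℝ) 1, 0 ≤ f.eval t) : 0 < zerothCoeff n hn f := by
  have h01 : (⟨0, by omega⟩ : Fin n) ≠ ⟨1, by omega⟩ := by simp
  set y : EuclideanSpace ℝ (Fin n) := EuclideanSpace.single ⟨0, by omega⟩ 1 with hy
  set z : EuclideanSpace ℝ (Fin n) := EuclideanSpace.single ⟨1, by omega⟩ 1 with hz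
  have hy1 : ‖y‖ = 1 := by simp [hy]
  have hz1 : ‖z‖ = 1 := by simp [hz]
  have hyz : inner ℝ y z = 0 := by simp [hy, hz, EuclideanSpace.inner_single_left]
  obtain ⟨t, ht, hft⟩ : ∃ t ∈ Set.Icc (-1 : ℝ) 1, f.eval t ≠ 0 := by
    by_contra! hcon
    refine hf (Polynomial.eq_zero_of_infinite_isRoot f ?_)
    exact (Set.Icc_infinite (by norm_num : (-1 : ℝ) < 1)).mono hcon
  have hs : 0 ≤ 1 - t ^ 2 := by nlinarith [ht.1, ht.2]
  -- As `n ≥ 2`, each `t` in `[-1, 1]` is the inner product of `y` with a point of the sphere; here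
  -- the continuous integrand is nonzero.
  set x : EuclideanSpace ℝ (Fin n) := t • y + Real.sqrt (1 - t ^ 2) • z with hx
  have hxy : inner ℝ x y = t := by
    rw [hx, inner_add_left, inner_smul_left, inner_smul_left, real_inner_comm y z, hyz,
      real_inner_self_eq_norm_sq, hy1]
    simp
  have hx1 : ‖x‖ = 1 := by
    have : ‖x‖ ^ 2 = 1 := by
      rw [hx, norm_add_sq_real, norm_smul, norm_smul, hy1, hz1, inner_smul_left, inner_smul_right,
        hyz]
      simp only [mul_one, Real.norm_eq_abs, sq_abs, mul_zero, add_zero]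
      rw [Real.sq_sqrt hs]
      ring
    nlinarith [norm_nonneg x]
  have : Nontrivial (EuclideanSpace ℝ (Fin n)) :=
    ⟨⟨y, 0, by intro h; rw [h] at hy1; simp at hy1⟩⟩
  rw [← zonalMean_eq_zerothCoeff hn y hy1]
  simp only [zonalMean, LinearMap.coe_mk, AddHom.coe_mk, average_eq, smul_eq_mul]
  refine mul_pos (inv_pos.2 ?_) ?_
  · rw [measureReal_def, ENNReal.toReal_pos_iff]
    exact ⟨Measure.measure_univ_pos.2 (Measure.toSphere_ne_zero _), measure_lt_top _ _⟩
  · refine integral_pos_of_integrable_nonneg_nonzero (x := ⟨x, by simp [hx1]⟩)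
      (f.continuous.comp (by fun_prop)) (integrable_sphere_eval_inner y f) (fun θ => ?_) ?_
    · refine hpos _ (abs_le.1 ?_)
      have h := abs_real_inner_le_norm (θ : EuclideanSpace ℝ (Fin n)) y
      have hθ : ‖(θ : EuclideanSpace ℝ (Fin n))‖ = 1 := by simp
      rwa [hθ, hy1, mul_one] at h
    · simp [hxy, hft]

/-- Substituting the linear form `⟨·, y⟩` into `f` gives a polynomial in `n` variables of total
degree at most `τ`, to which the design property applies. -/
theorem IsDesign.sum_eval_inner (hn : 2 ≤ n) {τ : ℕ} {S : Finset (EuclideanSpace ℝ (Fin n))}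
    (hS : IsDesign n τ S) {y : EuclideanSpace ℝ (Fin n)} (hy : ‖y‖ = 1) {f : ℝ[X]}
    (hf : f.natDegree ≤ τ) :
    ∑ x ∈ S, f.eval (inner ℝ x y) = S.card * zerothCoeff n hn f := by
  set ℓ : MvPolynomial (Fin n) ℝ := ∑ i, MvPolynomial.C (y i) * MvPolynomial.X i with hℓ
  have hℓe : ∀ x : EuclideanSpace ℝ (Fin n),
      MvPolynomial.eval (fun i => x i) ℓ = inner ℝ x y := by
    intro x
    simp [hℓ, PiLp.inner_apply]
  have hℓd : ℓ.totalDegree ≤ 1 := by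
    refine MvPolynomial.totalDegree_finsetSum_le fun i _ => ?_
    refine (MvPolynomial.totalDegree_mul _ _).trans ?_
    simp [MvPolynomial.totalDegree_X]
  have he : ∀ x : EuclideanSpace ℝ (Fin n),
      MvPolynomial.eval (fun i => x i) (aeval ℓ f) = f.eval (inner ℝ x y) := by
    intro x
    rw [← hℓe x, aeval_def, hom_eval₂, ← eval₂_id]
    congr 1
    ext r
    simp [MvPolynomial.algebraMap_eq]
  have hd : (aeval ℓ f).totalDegree ≤ τ := by
    rw [aeval_eq_sum_range]
    refine MvPolynomial.totalDegree_finsetSum_le fun i hi => ?_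
    refine (MvPolynomial.totalDegree_smul_le _ _).trans ((MvPolynomial.totalDegree_pow _ _).trans ?_)
    have : i ≤ f.natDegree := Nat.lt_succ_iff.1 (Finset.mem_range.1 hi)
    calc i * ℓ.totalDegree ≤ i * 1 := Nat.mul_le_mul_left _ hℓd
      _ ≤ τ := by omega
  have h := hS.mean_eq _ hd
  simp only [he] at h
  rw [← zonalMean_eq_zerothCoeff hn y hy]
  simp only [zonalMean, LinearMap.coe_mk, AddHom.coe_mk]
  have hc : (S.card : ℝ) ≠ 0 := by
    have := hS.nonempty.card_pos
    positivity
  rw [h]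
  field_simp

end SphereMean

end DesignEnergy

/-! ### Gauss-Radau quadrature for a positive functional. -/

namespace DesignEnergy

open Polynomial

section GaussRadau

variable {k : ℕ} {φ : ℝ[X] →ₗ[ℝ] ℝ}

/-- Positivity of a functional on the squares of degree at most `2k`, and on the squares of degree
less than `2k` multiplied by `1 - t²`. -/
structure IsPositiveUpTo (k : ℕ) (φ : ℝ[X] →ₗ[ℝ] ℝ) : Prop where
  sq_pos : ∀ q : ℝ[X], q ≠ 0 → q.natDegree ≤ k → 0 < φ (q ^ 2)
  mul_sq_pos : ∀ q : ℝ[X], q ≠ 0 → q.natDegree < k → 0 < φ ((1 - X ^ 2) * q ^ 2)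

theorem one_add_X_ne_zero : (1 + X : ℝ[X]) ≠ 0 := by
  rw [add_comm, ← C_1]
  exact X_add_C_ne_zero 1

theorem natDegree_one_add_X : (1 + X : ℝ[X]).natDegree = 1 := by
  rw [add_comm, ← C_1]
  exact natDegree_X_add_C 1

/-- The two positivity assumptions add up: `(1 + t)^2 + (1 - t^2) = 2 (1 + t)`. -/
theorem IsPositiveUpTo.one_add_mul_sq_pos (h : IsPositiveUpTo k φ) {q : ℝ[X]} (hq : q ≠ 0)
    (hd : q.natDegree < k) : 0 < φ ((1 + X) * q ^ 2) := by
  have h1 := h.sq_pos ((1 + X) * q) (mul_ne_zero one_add_X_ne_zero hq)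
    (natDegree_mul_le.trans (by rw [natDegree_one_add_X]; omega))
  have h2 := h.mul_sq_pos q hq hd
  have e : ((1 + X) * q) ^ 2 + (1 - X ^ 2) * q ^ 2 = (2 : ℝ) • ((1 + X) * q ^ 2) := by
    rw [smul_eq_C_mul, map_ofNat]
    ring
  have := congrArg φ e
  rw [map_add, map_smul, smul_eq_mul] at this
  linarith

/-- The monic orthogonal polynomial of degree `k` for the functional `f ↦ φ ((1 + t) f)`. -/
theorem IsPositiveUpTo.exists_orthogonal (h : IsPositiveUpTo k φ) :
    ∃ p : ℝ[X], p.Monic ∧ p.natDegree = k ∧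
      ∀ q : ℝ[X], q.natDegree < k → φ ((1 + X) * (p * q)) = 0 := by
  -- This form is positive definite, hence identifies the finite-dimensional space with its dual;
  -- the lower-order part `d` solves the orthogonality conditions for `X ^ k + d`.
  let B : degreeLT ℝ k →ₗ[ℝ] Module.Dual ℝ (degreeLT ℝ k) :=
    LinearMap.mk₂ ℝ (fun a b => φ ((1 + X) * (a * b : ℝ[X])))
      (by intros; simp [add_mul, mul_add]) (by intros; simp)
      (by intros; simp [mul_add]) (by intros; simp)
  have hB : ∀ a b, B a b = φ ((1 + X) * (a * b : ℝ[X])) := fun _ _ => rfl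
  have hlt : ∀ a : degreeLT ℝ k, (a : ℝ[X]) ≠ 0 → (a : ℝ[X]).natDegree < k := fun a ha =>
    (natDegree_lt_iff_degree_lt ha).2 (mem_degreeLT.1 a.2)
  have hinj : Function.Injective B := by
    rw [← LinearMap.ker_eq_bot, LinearMap.ker_eq_bot']
    intro a ha
    by_contra hne
    have hne' : (a : ℝ[X]) ≠ 0 := fun h => hne (Subtype.ext h)
    have := h.one_add_mul_sq_pos hne' (hlt a hne')
    rw [sq, ← hB, ha] at this
    simp at this
  have hsurj : Function.Surjective B :=
    (LinearMap.injective_iff_surjective_of_finrank_eq_finrank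
      Subspace.dual_finrank_eq.symm).1 hinj
  obtain ⟨d, hd⟩ := hsurj
    { toFun := fun b => -φ ((1 + X) * (X ^ k * (b : ℝ[X])))
      map_add' := by intros; simp [mul_add]; ring
      map_smul' := by intros; simp }
  have hdd : (d : ℝ[X]).degree < k := mem_degreeLT.1 d.2
  refine ⟨X ^ k + (d : ℝ[X]), monic_X_pow_add hdd, ?_, fun q hq => ?_⟩
  · exact natDegree_eq_of_degree_eq_some (by
      rw [degree_add_eq_left_of_degree_lt (by rwa [degree_X_pow]), degree_X_pow])
  · have hqm : q ∈ degreeLT ℝ k := by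
      rw [mem_degreeLT]
      exact degree_le_natDegree.trans_lt (by exact_mod_cast hq)
    have := congrArg (fun ψ => ψ ⟨q, hqm⟩) hd
    simp only [hB, LinearMap.coe_mk, AddHom.coe_mk] at this
    rw [add_mul (X ^ k), mul_add, map_add, this]
    ring

variable {p : ℝ[X]}

theorem natDegree_of_mul_eq {a q : ℝ[X]} (hp : p ≠ 0) (h : p = a * q) :
    a ≠ 0 ∧ q ≠ 0 ∧ p.natDegree = a.natDegree + q.natDegree := by
  subst h
  have := mul_ne_zero_iff.1 hp
  exact ⟨this.1, this.2, natDegree_mul this.1 this.2⟩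

/-- With `p = (t - a) q`, orthogonality to `q` turns the values of `φ` at `(1 - t^2) q^2` and `(1 +
t)^2 q^2` into `1 - a` and `1 + a` times its value at `(1 + t) q^2`; all of these values are
positive. -/
theorem IsPositiveUpTo.root_mem_Ioo (h : IsPositiveUpTo k φ) (hp : p.Monic) (hd : p.natDegree = k)
    (ho : ∀ q : ℝ[X], q.natDegree < k → φ ((1 + X) * (p * q)) = 0) {a : ℝ} (ha : p.IsRoot a) :
    a ∈ Set.Ioo (-1 : ℝ) 1 := by
  obtain ⟨q, hq⟩ := dvd_iff_isRoot.2 ha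
  obtain ⟨-, hq0, hdeg⟩ := natDegree_of_mul_eq hp.ne_zero hq
  rw [natDegree_X_sub_C] at hdeg
  have h0 := ho q (by omega)
  have h1 := h.one_add_mul_sq_pos hq0 (by omega)
  have h2 := h.mul_sq_pos q hq0 (by omega)
  have h3 := h.sq_pos ((1 + X) * q) (mul_ne_zero one_add_X_ne_zero hq0)
    (natDegree_mul_le.trans (by rw [natDegree_one_add_X]; omega))
  have e2 : (1 - X ^ 2) * q ^ 2 = (1 - a) • ((1 + X) * q ^ 2) - (1 + X) * (p * q) := by
    rw [smul_eq_C_mul, hq, C_sub, C_1]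
    ring
  have e3 : ((1 + X) * q) ^ 2 = (1 + a) • ((1 + X) * q ^ 2) + (1 + X) * (p * q) := by
    rw [smul_eq_C_mul, hq, C_add, C_1]
    ring
  rw [e2, map_sub, map_smul, h0, sub_zero, smul_eq_mul] at h2
  rw [e3, map_add, map_smul, h0, add_zero, smul_eq_mul] at h3
  have := pos_of_mul_pos_left h2 h1.le
  have := pos_of_mul_pos_left h3 h1.le
  constructor <;> linarith

/-- Dividing out a double root leaves `q` of degree below `k` for which `p * q` is a square,
contradicting orthogonality. -/
theorem IsPositiveUpTo.nodup_roots (h : IsPositiveUpTo k φ) (hp : p.Monic) (hd : p.natDegree = k)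
    (ho : ∀ q : ℝ[X], q.natDegree < k → φ ((1 + X) * (p * q)) = 0) : p.roots.Nodup := by
  rw [Multiset.nodup_iff_count_le_one]
  intro a
  rw [count_roots]
  by_contra! hcon
  obtain ⟨q, hq⟩ := (le_rootMultiplicity_iff hp.ne_zero).1 hcon
  obtain ⟨-, hq0, hdeg⟩ := natDegree_of_mul_eq hp.ne_zero hq
  rw [natDegree_pow, natDegree_X_sub_C] at hdeg
  have h0 := ho q (by omega)
  have h1 := h.one_add_mul_sq_pos (q := (X - C a) * q) (mul_ne_zero (X_sub_C_ne_zero a) hq0)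
    (natDegree_mul_le.trans_lt (by rw [natDegree_X_sub_C]; omega))
  have e : (1 + X) * (p * q) = (1 + X) * ((X - C a) * q) ^ 2 := by rw [hq]; ring
  rw [← e, h0] at h1
  exact lt_irrefl _ h1

/-- A nonreal root gives a factor `(t - Re z)^2 + (Im z)^2`; its cofactor `q` makes `p * q` a sum of
squares. -/
theorem IsPositiveUpTo.im_eq_zero (h : IsPositiveUpTo k φ) (hp : p.Monic) (hd : p.natDegree = k)
    (ho : ∀ q : ℝ[X], q.natDegree < k → φ ((1 + X) * (p * q)) = 0) {z : ℂ}
    (hz : aeval z p = 0) : z.im = 0 := by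
  by_contra him
  obtain ⟨q, hq⟩ := p.quadratic_dvd_of_aeval_eq_zero_im_ne_zero hz him
  have hQ : (X ^ 2 - C (2 * z.re) * X + C (‖z‖ ^ 2) : ℝ[X]) =
      (X - C z.re) ^ 2 + C (z.im ^ 2) := by
    rw [← Complex.normSq_eq_norm_sq, Complex.normSq_apply]
    simp only [C_mul, C_add, C_pow, map_ofNat]
    ring
  rw [hQ] at hq
  obtain ⟨-, hq0, hdeg⟩ := natDegree_of_mul_eq hp.ne_zero hq
  have hQd : ((X - C z.re) ^ 2 + C (z.im ^ 2) : ℝ[X]).natDegree = 2 := by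
    rw [natDegree_add_C, natDegree_pow, natDegree_X_sub_C]
  rw [hQd] at hdeg
  have h0 := ho q (by omega)
  have h1 := h.one_add_mul_sq_pos (q := (X - C z.re) * q) (mul_ne_zero (X_sub_C_ne_zero _) hq0)
    (natDegree_mul_le.trans_lt (by rw [natDegree_X_sub_C]; omega))
  have h2 := h.one_add_mul_sq_pos hq0 (by omega)
  have e : (1 + X) * (p * q) =
      (1 + X) * ((X - C z.re) * q) ^ 2 + (z.im ^ 2) • ((1 + X) * q ^ 2) := by
    rw [hq, smul_eq_C_mul]; ring
  rw [e, map_add, map_smul, smul_eq_mul] at h0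
  have := mul_nonneg (sq_nonneg z.im) h2.le
  linarith

theorem IsPositiveUpTo.card_roots (h : IsPositiveUpTo k φ) (hp : p.Monic) (hd : p.natDegree = k)
    (ho : ∀ q : ℝ[X], q.natDegree < k → φ ((1 + X) * (p * q)) = 0) :
    p.roots.card = k := by
  obtain ⟨q, hq, hcard, hroots⟩ := exists_prod_multiset_X_sub_C_mul p
  suffices hq0 : q.natDegree = 0 by rw [hq0, add_zero] at hcard; exact hcard.trans hd
  by_contra hne
  have hq1 : q.degree ≠ 0 := fun h => hne (natDegree_eq_of_degree_eq_some h)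
  obtain ⟨z, hz⟩ := IsAlgClosed.exists_aeval_eq_zero ℂ q hq1
  have him := h.im_eq_zero hp hd ho (z := z) (by rw [← hq, map_mul, hz, mul_zero])
  have hzr : z = algebraMap ℝ ℂ z.re := by
    apply Complex.ext <;> simp [him]
  rw [hzr, aeval_algebraMap_apply, map_eq_zero, coe_aeval_eq_eval] at hz
  have hqne : q ≠ 0 := by rintro rfl; simp at hne
  have : z.re ∈ q.roots := (mem_roots hqne).2 hz
  simp [hroots] at this

/-- `β` and `γ` are nodes and weights of a quadrature formula for `φ`, exact up to degree `2k`, with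
the fixed node `-1`. -/
structure IsRadauQuadrature (k : ℕ) (φ : ℝ[X] →ₗ[ℝ] ℝ) (β γ : Fin (k + 1) → ℝ) : Prop where
  node_zero : β 0 = -1
  strictMono : StrictMono β
  exact_on : ∀ f : ℝ[X], f.natDegree ≤ 2 * k → φ f = ∑ i, γ i * f.eval (β i)

variable {β γ β' γ' : Fin (k + 1) → ℝ}

theorem natDegree_basis_univ (hβ : StrictMono β) (i : Fin (k + 1)) :
    (Lagrange.basis Finset.univ β i).natDegree = k := by
  have h := Lagrange.degree_basis (s := Finset.univ) (hβ.injective.injOn) (Finset.mem_univ i)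
  rw [Finset.card_univ, Fintype.card_fin, Nat.add_sub_cancel] at h
  exact natDegree_eq_of_degree_eq_some h

theorem basis_univ_ne_zero (hβ : StrictMono β) (i : Fin (k + 1)) :
    Lagrange.basis Finset.univ β i ≠ 0 :=
  Lagrange.basis_ne_zero hβ.injective.injOn (Finset.mem_univ i)

theorem eval_basis_univ (hβ : StrictMono β) (i j : Fin (k + 1)) :
    (Lagrange.basis Finset.univ β i).eval (β j) = if i = j then 1 else 0 := by
  split_ifs with h
  · subst h
    exact Lagrange.eval_basis_self hβ.injective.injOn (Finset.mem_univ _)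
  · exact Lagrange.eval_basis_of_ne h (Finset.mem_univ _)

theorem IsRadauQuadrature.weight_eq (hq : IsRadauQuadrature k φ β γ) (i : Fin (k + 1)) :
    γ i = φ (Lagrange.basis Finset.univ β i) := by
  rw [hq.exact_on _ (by rw [natDegree_basis_univ hq.strictMono]; omega)]
  simp [eval_basis_univ hq.strictMono]

/-- The square of a Lagrange basis polynomial has degree `2k`, so the rule is still exact on it and
returns the weight. -/
theorem IsRadauQuadrature.weight_pos (h : IsPositiveUpTo k φ) (hq : IsRadauQuadrature k φ β γ)
    (i : Fin (k + 1)) : 0 < γ i := by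
  have h1 := h.sq_pos _ (basis_univ_ne_zero hq.strictMono i)
    (natDegree_basis_univ hq.strictMono i).le
  rw [hq.exact_on _ (by rw [natDegree_pow, natDegree_basis_univ hq.strictMono])] at h1
  simpa [eval_basis_univ hq.strictMono] using h1

theorem natDegree_prod_nodes (b : Fin k → ℝ) : (∏ i, (X - C (b i))).natDegree = k := by
  rw [natDegree_prod_of_monic _ _ fun i _ => monic_X_sub_C _]
  simp

theorem IsRadauQuadrature.orthogonal (hq : IsRadauQuadrature k φ β γ) {q : ℝ[X]}
    (hd : q.natDegree < k) :
    φ ((1 + X) * ((∏ i : Fin k, (X - C (β i.succ))) * q)) = 0 := by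
  rw [hq.exact_on]
  · refine Finset.sum_eq_zero fun i _ => ?_
    refine Fin.cases ?_ (fun i => ?_) i
    · simp [hq.node_zero]
    · rw [eval_mul, eval_mul, eval_prod, Finset.prod_eq_zero (Finset.mem_univ i)] <;> simp
  · refine natDegree_mul_le.trans ?_
    have := natDegree_mul_le (p := ∏ i : Fin k, (X - C (β i.succ))) (q := q)
    rw [natDegree_prod_nodes] at this
    rw [natDegree_one_add_X]
    omega

/-- Both free nodal polynomials are monic and orthogonal to lower degrees, so their difference is
orthogonal to itself and vanishes. Equal nodes force equal weights. -/
theorem IsRadauQuadrature.unique (h : IsPositiveUpTo k φ) (hq : IsRadauQuadrature k φ β γ)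
    (hq' : IsRadauQuadrature k φ β' γ') : β = β' ∧ γ = γ' := by
  set p : ℝ[X] := ∏ i : Fin k, (X - C (β i.succ)) with hp
  set p' : ℝ[X] := ∏ i : Fin k, (X - C (β' i.succ)) with hp'
  have hpp : p = p' := by
    by_contra hne
    have hm : p.Monic := monic_prod_of_monic _ _ fun i _ => monic_X_sub_C _
    have hm' : p'.Monic := monic_prod_of_monic _ _ fun i _ => monic_X_sub_C _
    have hd : p.natDegree = k := natDegree_prod_nodes _
    have hd' : p'.natDegree = k := natDegree_prod_nodes _
    have hs : p - p' ≠ 0 := sub_ne_zero.2 hne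
    have hlt : (p - p').natDegree < k := by
      rw [natDegree_lt_iff_degree_lt hs]
      have := degree_sub_lt_left (p := p) (q := p')
        (by rw [degree_eq_natDegree hm.ne_zero, degree_eq_natDegree hm'.ne_zero, hd, hd'])
        hm.ne_zero (by rw [hm.leadingCoeff, hm'.leadingCoeff])
      rwa [degree_eq_natDegree hm.ne_zero, hd] at this
    have h1 := h.one_add_mul_sq_pos hs hlt
    have e : (1 + X) * (p - p') ^ 2 = (1 + X) * (p * (p - p')) - (1 + X) * (p' * (p - p')) := by
      ring
    rw [e, map_sub, hq.orthogonal hlt, hq'.orthogonal hlt, sub_zero] at h1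
    exact lt_irrefl _ h1
  have hsucc : (fun i : Fin k => β i.succ) = fun i : Fin k => β' i.succ := by
    have hm : StrictMono fun i : Fin k => β i.succ :=
      hq.strictMono.comp (Fin.strictMono_succ)
    have hm' : StrictMono fun i : Fin k => β' i.succ :=
      hq'.strictMono.comp (Fin.strictMono_succ)
    refine (StrictMono.range_inj hm hm').1 ?_
    have hr : ∀ b : Fin k → ℝ, Set.range b = {t | (∏ i : Fin k, (X - C (b i))).eval t = 0} := by
      intro b
      ext t
      simp [eval_prod, Finset.prod_eq_zero_iff, sub_eq_zero, eq_comm (a := t)]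
    rw [hr, hr]
    change {t | p.eval t = 0} = {t | p'.eval t = 0}
    rw [hpp]
  have hβ : β = β' := by
    funext i
    refine Fin.cases ?_ (fun i => ?_) i
    · rw [hq.node_zero, hq'.node_zero]
    · exact congrFun hsucc i
  subst hβ
  exact ⟨rfl, funext fun i => by rw [hq.weight_eq, hq'.weight_eq]⟩

theorem IsPositiveUpTo.exists_quadrature (h : IsPositiveUpTo k φ) :
    ∃ β γ : Fin (k + 1) → ℝ, IsRadauQuadrature k φ β γ ∧ ∀ i, β i < 1 := by
  obtain ⟨p, hp, hd, ho⟩ := h.exists_orthogonal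
  have hcard : p.roots.toFinset.card = k := by
    rw [Multiset.toFinset_card_of_nodup (h.nodup_roots hp hd ho), h.card_roots hp hd ho]
  set b : Fin k → ℝ := ⇑(p.roots.toFinset.orderEmbOfFin hcard)
  have hbr : ∀ i, p.IsRoot (b i) := fun i =>
    (mem_roots hp.ne_zero).1 (Multiset.mem_toFinset.1 (Finset.orderEmbOfFin_mem _ hcard i))
  have hbm : StrictMono b := (p.roots.toFinset.orderEmbOfFin hcard).strictMono
  set β : Fin (k + 1) → ℝ := Fin.cons (-1) b with hβ
  have hβm : StrictMono β := by
    intro i j hij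
    induction i using Fin.cases with
    | zero =>
      induction j using Fin.cases with
      | zero => exact absurd hij (lt_irrefl _)
      | succ j => simpa [hβ] using (h.root_mem_Ioo hp hd ho (hbr j)).1
    | succ i =>
      induction j using Fin.cases with
      | zero => exact absurd hij (Fin.not_lt_zero _)
      | succ j => simpa [hβ] using hbm (Fin.succ_lt_succ_iff.1 hij)
  have hβ1 : ∀ i, β i < 1 := by
    intro i
    refine Fin.cases ?_ (fun i => ?_) i
    · simp [hβ]
    · simpa [hβ] using (h.root_mem_Ioo hp hd ho (hbr i)).2
  have hw : ((1 + X) * p).Monic := by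
    refine Monic.mul ?_ hp
    rw [add_comm, ← C_1]
    exact monic_X_add_C 1
  have hwd : ((1 + X) * p).natDegree = k + 1 := by
    rw [natDegree_mul one_add_X_ne_zero hp.ne_zero, natDegree_one_add_X, hd, add_comm]
  have hwz : ∀ i, ((1 + X) * p).eval (β i) = 0 := by
    intro i
    refine Fin.cases ?_ (fun i => ?_) i
    · simp [hβ]
    · have := hbr i
      rw [IsRoot] at this
      simp [hβ, this]
  refine ⟨β, fun i => φ (Lagrange.basis Finset.univ β i), ⟨by simp [hβ], hβm, fun f hf => ?_⟩, hβ1⟩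
  -- The remainder is interpolated at the nodes, and the quotient has degree at most `k - 1`, so
  -- orthogonality kills its contribution. For `k = 0` the quotient is zero.
  have hf' := modByMonic_add_div f ((1 + X) * p)
  have hrd : (f %ₘ ((1 + X) * p)).degree < (Finset.univ : Finset (Fin (k + 1))).card := by
    have := degree_modByMonic_lt f hw
    rw [degree_eq_natDegree hw.ne_zero, hwd] at this
    simpa using this
  have hr := Lagrange.eq_interpolate (s := Finset.univ) (v := β) hβm.injective.injOn hrd
  have hz : φ ((1 + X) * p * (f /ₘ ((1 + X) * p))) = 0 := by
    by_cases hk : k = 0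
    · have : f /ₘ ((1 + X) * p) = 0 := by
        refine (divByMonic_eq_zero_iff hw).2 ?_
        refine degree_lt_degree ?_
        rw [hwd]
        omega
      rw [this, mul_zero, map_zero]
    · rw [mul_assoc]
      refine ho _ ?_
      rw [natDegree_divByMonic f hw, hwd]
      omega
  have hev : ∀ i, (f %ₘ ((1 + X) * p)).eval (β i) = f.eval (β i) := by
    intro i
    conv_rhs => rw [← hf']
    rw [eval_add, eval_mul, hwz, zero_mul, add_zero]
  conv_lhs => rw [← hf', map_add, hz, add_zero, hr, Lagrange.interpolate_apply]
  rw [map_sum]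
  refine Finset.sum_congr rfl fun i _ => ?_
  rw [← smul_eq_C_mul, map_smul, hev, smul_eq_mul, mul_comm]

end GaussRadau

end DesignEnergy

/-! ### Rolle's theorem and Hermite interpolation. -/

namespace DesignEnergy

open Polynomial Set
open scoped ContDiff

section Rolle

theorem natCast_le_smooth (m : ℕ) : ((m : ℕ) : WithTop ℕ∞) ≤ ∞ := by exact_mod_cast le_top

/-- Rolle's theorem between consecutive points of a finite set of zeros. -/
theorem exists_finset_deriv_eq_zero {f : ℝ → ℝ} {a b : ℝ} {m : ℕ} (Z : Finset ℝ)
    (hf : ContinuousOn f (Ico a b)) (hZ : ∀ z ∈ Z, z ∈ Ico a b ∧ f z = 0)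
    (hcard : Z.card = m + 1) :
    ∃ D : Finset ℝ, D.card = m ∧ Disjoint D Z ∧ ∀ z ∈ D, z ∈ Ioo a b ∧ deriv f z = 0 := by
  set x := Z.orderEmbOfFin hcard with hx
  have hxm : StrictMono x := (Z.orderEmbOfFin hcard).strictMono
  have hxZ : ∀ i, x i ∈ Z := fun i => Finset.orderEmbOfFin_mem _ hcard i
  have hsur : ∀ z ∈ Z, ∃ i, x i = z := fun z hz => by
    have : z ∈ Set.range x := by rw [hx, Finset.range_orderEmbOfFin]; exact hz
    exact this
  have hr : ∀ i : Fin m, ∃ c ∈ Ioo (x i.castSucc) (x i.succ), deriv f c = 0 := fun i =>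
    exists_deriv_eq_zero (hxm Fin.castSucc_lt_succ)
      (hf.mono fun t ht => ⟨(hZ _ (hxZ _)).1.1.trans ht.1, ht.2.trans_lt (hZ _ (hxZ _)).1.2⟩)
      (by rw [(hZ _ (hxZ _)).2, (hZ _ (hxZ _)).2])
  choose c hc hc0 using hr
  have hcm : StrictMono c := by
    intro i j hij
    have h1 : x i.succ ≤ x j.castSucc := hxm.monotone (by
      rw [Fin.le_def]; simpa using hij)
    exact (hc i).2.trans_le (h1.trans (hc j).1.le)
  refine ⟨Finset.univ.image c, ?_, ?_, ?_⟩
  · rw [Finset.card_image_of_injective _ hcm.injective, Finset.card_univ, Fintype.card_fin]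
  · rw [Finset.disjoint_left]
    intro z hz hzZ
    obtain ⟨i, -, rfl⟩ := Finset.mem_image.1 hz
    obtain ⟨j, hj⟩ := hsur _ hzZ
    have h1 := hxm.lt_iff_lt.1 (hj ▸ (hc i).1 : x i.castSucc < x j)
    have h2 := hxm.lt_iff_lt.1 (hj ▸ (hc i).2 : x j < x i.succ)
    rw [Fin.lt_def] at h1 h2
    simp at h1 h2
    omega
  · intro z hz
    obtain ⟨i, -, rfl⟩ := Finset.mem_image.1 hz
    exact ⟨⟨(hZ _ (hxZ _)).1.1.trans_lt (hc i).1, (hc i).2.trans (hZ _ (hxZ _)).1.2⟩, hc0 i⟩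

theorem contDiffOn_deriv {f : ℝ → ℝ} {a b : ℝ} (hf : ContDiffOn ℝ ∞ f (Ioo a b)) :
    ContDiffOn ℝ ∞ (deriv f) (Ioo a b) :=
  hf.deriv_of_isOpen isOpen_Ioo (by simp)

theorem contDiffOn_iteratedDeriv {f : ℝ → ℝ} {a b : ℝ} (hf : ContDiffOn ℝ ∞ f (Ioo a b)) (m : ℕ) :
    ContDiffOn ℝ ∞ (iteratedDeriv m f) (Ioo a b) := by
  induction m with
  | zero => simpa using hf
  | succ m ih =>
    rw [iteratedDeriv_succ]
    exact contDiffOn_deriv ih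

theorem hasDerivAt_iteratedDeriv {f : ℝ → ℝ} {a b : ℝ} (hf : ContDiffOn ℝ ∞ f (Ioo a b)) (m : ℕ)
    {x : ℝ} (hx : x ∈ Ioo a b) : HasDerivAt (iteratedDeriv m f) (iteratedDeriv (m + 1) f x) x := by
  rw [iteratedDeriv_succ]
  exact (((contDiffOn_iteratedDeriv hf m).contDiffAt (Ioo_mem_nhds hx.1 hx.2)).differentiableAt
    (by simp)).hasDerivAt

/-- A smooth function with `m + 1` zeros has a zero of its `m`-th derivative. -/
theorem exists_iteratedDeriv_eq_zero {a b : ℝ} (m : ℕ) :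
    ∀ {f : ℝ → ℝ} (Z : Finset ℝ), ContDiffOn ℝ ∞ f (Ioo a b) →
      (∀ z ∈ Z, z ∈ Ioo a b ∧ f z = 0) → Z.card = m + 1 →
      ∃ ξ ∈ Ioo a b, iteratedDeriv m f ξ = 0 := by
  induction m with
  | zero =>
    intro f Z _ hZ hcard
    obtain ⟨z, hz⟩ := Finset.card_pos.1 (by omega : 0 < Z.card)
    exact ⟨z, (hZ z hz).1, by simpa using (hZ z hz).2⟩
  | succ m ih =>
    intro f Z hf hZ hcard
    have hne : Z.Nonempty := Finset.card_pos.1 (by omega)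
    set a' := Z.min' hne with ha'
    have haa : a < a' := (hZ _ (Z.min'_mem hne)).1.1
    obtain ⟨D, hD, -, hDz⟩ := exists_finset_deriv_eq_zero (a := a') (b := b) Z
      (hf.continuousOn.mono fun t ht => ⟨haa.trans_le ht.1, ht.2⟩)
      (fun z hz => ⟨⟨Z.min'_le z hz, (hZ z hz).1.2⟩, (hZ z hz).2⟩) hcard
    obtain ⟨ξ, hξ, h⟩ := ih D (contDiffOn_deriv hf)
      (fun z hz => ⟨⟨haa.trans (hDz z hz).1.1, (hDz z hz).1.2⟩, (hDz z hz).2⟩) hD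
    exact ⟨ξ, hξ, by rw [iteratedDeriv_succ']; exact h⟩

theorem iterate_derivative_eq_C {p : ℝ[X]} {m : ℕ} (hp : p.natDegree ≤ m) :
    derivative^[m] p = C (m.factorial * p.coeff m) := by
  have h : (derivative^[m] p).natDegree ≤ 0 := (natDegree_iterate_derivative p m).trans (by omega)
  rw [eq_C_of_natDegree_le_zero h, coeff_iterate_derivative]
  simp [Nat.descFactorial_self]

theorem iteratedDeriv_eval (p : ℝ[X]) (m : ℕ) :
    iteratedDeriv m (fun x => p.eval x) = fun x => (derivative^[m] p).eval x := by
  induction m with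
  | zero => simp
  | succ m ih =>
    rw [iteratedDeriv_succ, ih, Function.iterate_succ_apply']
    funext x
    exact Polynomial.deriv _

end Rolle

section Hermite

variable {k : ℕ} {a : ℝ} {b : Fin k → ℝ}

/-- The polynomial vanishing at `a` and, to second order, at the points `b i`. -/
noncomputable def hermiteNodal (a : ℝ) (b : Fin k → ℝ) : ℝ[X] := (X - C a) * ∏ i, (X - C (b i)) ^ 2

theorem hermiteNodal_monic (a : ℝ) (b : Fin k → ℝ) : (hermiteNodal a b).Monic :=
  (monic_X_sub_C a).mul (monic_prod_of_monic _ _ fun _ _ => (monic_X_sub_C _).pow 2)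

theorem hermiteNodal_natDegree (a : ℝ) (b : Fin k → ℝ) :
    (hermiteNodal a b).natDegree = 2 * k + 1 := by
  rw [hermiteNodal, (monic_X_sub_C a).natDegree_mul
    (monic_prod_of_monic _ _ fun _ _ => (monic_X_sub_C _).pow 2), natDegree_X_sub_C,
    natDegree_prod_of_monic _ _ fun _ _ => (monic_X_sub_C _).pow 2]
  simp
  ring

theorem hermiteNodal_eval (a : ℝ) (b : Fin k → ℝ) (t : ℝ) :
    (hermiteNodal a b).eval t = (t - a) * ∏ i, (t - b i) ^ 2 := by
  simp [hermiteNodal, eval_prod]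

theorem hermiteNodal_dvd (hb : Function.Injective b) (ha : ∀ i, b i ≠ a) {p : ℝ[X]}
    (h0 : p.eval a = 0) (h1 : ∀ i, p.eval (b i) = 0) (h2 : ∀ i, (derivative p).eval (b i) = 0) :
    hermiteNodal a b ∣ p := by
  refine IsCoprime.mul_dvd ?_ (dvd_iff_isRoot.2 h0) ?_
  · refine IsCoprime.prod_right fun i _ => IsCoprime.pow_right ?_
    exact isCoprime_X_sub_C_of_isUnit_sub (sub_ne_zero.2 (ha i).symm).isUnit
  · refine Finset.prod_dvd_of_coprime (fun i _ j _ hij => ?_) fun i _ => ?_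
    · exact (pairwise_coprime_X_sub_C hb hij).pow
    · by_cases hp : p = 0
      · simp [hp]
      · exact (le_rootMultiplicity_iff hp).1
          ((one_lt_rootMultiplicity_iff_isRoot hp).2 ⟨h1 i, h2 i⟩)

/-- The data map goes between spaces of dimension `2k + 1` and is injective: a polynomial in its
kernel is divisible by the nodal polynomial, of degree `2k + 1`. -/
theorem exists_hermite_interpolant (hb : Function.Injective b) (ha : ∀ i, b i ≠ a) (u : ℝ)
    (v w : Fin k → ℝ) :
    ∃! G : ℝ[X], G.natDegree ≤ 2 * k ∧ G.eval a = u ∧ (∀ i, G.eval (b i) = v i) ∧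
      ∀ i, (derivative G).eval (b i) = w i := by
  have huniq : ∀ p : ℝ[X], p.natDegree ≤ 2 * k → p.eval a = 0 → (∀ i, p.eval (b i) = 0) →
      (∀ i, (derivative p).eval (b i) = 0) → p = 0 := by
    intro p hd h0 h1 h2
    refine eq_zero_of_dvd_of_natDegree_lt (hermiteNodal_dvd hb ha h0 h1 h2) ?_
    rw [hermiteNodal_natDegree]
    omega
  let T : degreeLT ℝ (2 * k + 1) →ₗ[ℝ] ℝ × (Fin k → ℝ) × (Fin k → ℝ) :=
    { toFun := fun p => ((p : ℝ[X]).eval a, fun i => (p : ℝ[X]).eval (b i),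
        fun i => (derivative (p : ℝ[X])).eval (b i))
      map_add' := by intros; ext <;> simp
      map_smul' := by intros; ext <;> simp }
  have hdeg : ∀ p : ℝ[X], p ∈ degreeLT ℝ (2 * k + 1) ↔ p.natDegree ≤ 2 * k := by
    intro p
    rw [degreeLT_succ_eq_degreeLE, mem_degreeLE, natDegree_le_iff_degree_le]
  have hinj : Function.Injective T := by
    rw [← LinearMap.ker_eq_bot, LinearMap.ker_eq_bot']
    intro p hp
    have h0 : (p : ℝ[X]).eval a = 0 := congrArg Prod.fst hp
    have h1 : (fun i => (p : ℝ[X]).eval (b i)) = 0 := congrArg (fun z => z.2.1) hp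
    have h2 : (fun i => (derivative (p : ℝ[X])).eval (b i)) = 0 := congrArg (fun z => z.2.2) hp
    exact Subtype.ext (huniq p ((hdeg p).1 p.2) h0 (congrFun h1) (congrFun h2))
  have hsurj : Function.Surjective T := by
    refine (LinearMap.injective_iff_surjective_of_finrank_eq_finrank ?_).1 hinj
    rw [(degreeLTEquiv ℝ (2 * k + 1)).finrank_eq]
    simp
    ring
  obtain ⟨G, hG⟩ := hsurj (u, v, w)
  have h0 : (G : ℝ[X]).eval a = u := congrArg Prod.fst hG
  have h1 : (fun i => (G : ℝ[X]).eval (b i)) = v := congrArg (fun z => z.2.1) hG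
  have h2 : (fun i => (derivative (G : ℝ[X])).eval (b i)) = w := congrArg (fun z => z.2.2) hG
  refine ⟨G, ⟨(hdeg G).1 G.2, h0, congrFun h1, congrFun h2⟩, fun H hH => ?_⟩
  refine sub_eq_zero.1 (huniq (H - G) ?_ ?_ ?_ ?_)
  · exact (natDegree_sub_le _ _).trans (max_le hH.1 ((hdeg G).1 G.2))
  · rw [eval_sub, hH.2.1, h0, sub_self]
  · intro i
    rw [eval_sub, hH.2.2.1, ← congrFun h1 i, sub_self]
  · intro i
    rw [derivative_sub, eval_sub, hH.2.2.2, ← congrFun h2 i, sub_self]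

/-- The error formula of Hermite interpolation at `a` and, to first order, at the points `b i`. -/
theorem exists_hermite_error {l r : ℝ} {f : ℝ → ℝ} (hc : ContinuousOn f (Ico l r))
    (hs : ContDiffOn ℝ ∞ f (Ioo l r)) (hbi : Function.Injective b) (hb : ∀ i, b i ∈ Ioo l r)
    (hab : ∀ i, b i ≠ a) (ha : a ∈ Ico l r) {G : ℝ[X]} (hG : G.natDegree ≤ 2 * k)
    (h0 : G.eval a = f a) (h1 : ∀ i, G.eval (b i) = f (b i))
    (h2 : ∀ i, (derivative G).eval (b i) = deriv f (b i)) {t : ℝ} (ht : t ∈ Ico l r) :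
    ∃ ξ ∈ Ioo l r, ((2 * k + 1).factorial : ℝ) * (f t - G.eval t) =
      iteratedDeriv (2 * k + 1) f ξ * ((t - a) * ∏ i, (t - b i) ^ 2) := by
  have hlr : l < r := ht.1.trans_lt ht.2
  by_cases hta : t = a
  · exact ⟨(l + r) / 2, ⟨by linarith, by linarith⟩, by rw [hta, h0]; ring⟩
  by_cases htb : ∃ i, t = b i
  · obtain ⟨i, rfl⟩ := htb
    refine ⟨_, hb i, ?_⟩
    rw [h1, Finset.prod_eq_zero (Finset.mem_univ i) (by simp)]
    ring
  push Not at htb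
  set w := hermiteNodal a b with hw
  have hwt : w.eval t ≠ 0 := by
    rw [hw, hermiteNodal_eval]
    refine mul_ne_zero (sub_ne_zero.2 hta) (Finset.prod_ne_zero_iff.2 fun i _ => ?_)
    exact pow_ne_zero _ (sub_ne_zero.2 (htb i))
  -- This constant makes `f - Q` vanish at `t` too, without disturbing the interpolation conditions.
  set c := (f t - G.eval t) / w.eval t with hcdef
  set Q := G + C c * w with hQ
  have hwb : ∀ i, w.eval (b i) = 0 := by
    intro i
    rw [hw, hermiteNodal_eval, Finset.prod_eq_zero (Finset.mem_univ i) (by simp), mul_zero]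
  have hwb' : ∀ i, (derivative w).eval (b i) = 0 := by
    intro i
    have : (X - C (b i)) ^ 2 ∣ w :=
      Dvd.dvd.mul_left (Finset.dvd_prod_of_mem (fun i => (X - C (b i)) ^ 2) (Finset.mem_univ i)) _
    obtain ⟨v, hv⟩ := this
    rw [hv]
    simp [derivative_pow]
  set F : ℝ → ℝ := fun x => f x - Q.eval x with hF
  have hQs : ContDiff ℝ ∞ fun x => Q.eval x := by
    simpa using Q.contDiff_aeval (𝕜 := ℝ) ∞
  have hFs : ContDiffOn ℝ ∞ F (Ioo l r) := hs.sub hQs.contDiffOn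
  have hFc : ContinuousOn F (Ico l r) := hc.sub Q.continuousOn
  set B : Finset ℝ := Finset.univ.image b with hB
  have hBc : B.card = k := by
    rw [hB, Finset.card_image_of_injective _ hbi, Finset.card_univ, Fintype.card_fin]
  have haB : a ∉ B := by simp [hB, hab]
  have htB : t ∉ insert a B := by
    simp only [hB, Finset.mem_insert, Finset.mem_image, Finset.mem_univ, true_and, not_or,
      not_exists]
    exact ⟨hta, fun i h => htb i h.symm⟩
  -- The `k + 2` zeros `t`, `a`, `b i` of `F` give `k + 1` new zeros of its derivative, which with
  -- the `b i` make `2k + 1`.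
  obtain ⟨D, hD, hdisj, hDz⟩ := exists_finset_deriv_eq_zero (m := k + 1) (insert t (insert a B)) hFc
    (by
      intro z hz
      rw [Finset.mem_insert, Finset.mem_insert, hB, Finset.mem_image] at hz
      rcases hz with rfl | rfl | ⟨i, -, rfl⟩
      · refine ⟨ht, ?_⟩
        simp only [hF, hQ, eval_add, eval_mul, eval_C, hcdef]
        field_simp
        ring
      · refine ⟨ha, ?_⟩
        simp [hF, hQ, h0, hw, hermiteNodal_eval]
      · refine ⟨Ioo_subset_Ico_self (hb i), ?_⟩
        simp [hF, hQ, h1, hwb])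
    (by rw [Finset.card_insert_of_notMem htB, Finset.card_insert_of_notMem haB, hBc])
  have hdBD : Disjoint D B := hdisj.mono_right
    ((Finset.subset_insert a B).trans (Finset.subset_insert t _))
  obtain ⟨ξ, hξ, hξ0⟩ := exists_iteratedDeriv_eq_zero (2 * k) (D ∪ B) (contDiffOn_deriv hFs)
    (by
      intro z hz
      rcases Finset.mem_union.1 hz with hz | hz
      · exact hDz z hz
      · obtain ⟨i, -, rfl⟩ := Finset.mem_image.1 hz
        refine ⟨hb i, ?_⟩
        have hd : DifferentiableAt ℝ f (b i) :=
          (hs.contDiffAt (Ioo_mem_nhds (hb i).1 (hb i).2)).differentiableAt (by simp)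
        rw [hF, deriv_fun_sub hd Q.differentiableAt, Polynomial.deriv, hQ]
        simp [h2, hwb'])
    (by rw [Finset.card_union_of_disjoint hdBD, hD, hBc]; ring)
  refine ⟨ξ, hξ, ?_⟩
  rw [← iteratedDeriv_succ', hF, iteratedDeriv_fun_sub
    ((hs.contDiffAt (Ioo_mem_nhds hξ.1 hξ.2)).of_le (natCast_le_smooth _))
    (hQs.contDiffAt.of_le (natCast_le_smooth _)), iteratedDeriv_eval] at hξ0
  have hwd : w.natDegree = 2 * k + 1 := hermiteNodal_natDegree a b
  have hwm : w.coeff (2 * k + 1) = 1 := by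
    rw [← hwd]; exact hermiteNodal_monic a b
  have hQd : Q.natDegree ≤ 2 * k + 1 :=
    natDegree_add_le_of_degree_le (hG.trans (by omega)) ((natDegree_C_mul_le _ _).trans hwd.le)
  have hQc : Q.coeff (2 * k + 1) = c := by
    rw [hQ, coeff_add, coeff_C_mul, hwm, coeff_eq_zero_of_natDegree_lt (by omega)]
    ring
  rw [iterate_derivative_eq_C hQd, hQc] at hξ0
  simp only [eval_C, sub_eq_zero] at hξ0
  rw [hξ0, ← hermiteNodal_eval, ← hw, hcdef]
  field_simp

end Hermite

/-! ### Rigidity of absolutely monotone functions. -/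

section AbsolutelyMonotone

/-- If all members of a sequence of successive derivatives are nonnegative on `[a, r)` and vanish
at `a`, then the first one vanishes on `[a, r)`. -/
theorem eq_zero_of_nonneg_derivatives {a r : ℝ} {g : ℕ → ℝ → ℝ}
    (hg : ∀ j, ∀ x ∈ Ico a r, HasDerivAt (g j) (g (j + 1) x) x)
    (hpos : ∀ j, ∀ x ∈ Ico a r, 0 ≤ g j x) (h0 : ∀ j, g j a = 0) {t : ℝ} (ht : t ∈ Ico a r) :
    g 0 t = 0 := by
  -- The inequality for `p` at `j + 1` says that the difference of the two sides for `p + 1` at `j`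
  -- is nondecreasing, starting from 0. Letting `p` grow forces `g 0` to vanish.
  have key : ∀ p : ℕ, ∀ j, ∀ x ∈ Ico a r, p * g j x ≤ (x - a) * g (j + 1) x := by
    intro p
    induction p with
    | zero =>
      intro j x hx
      have := mul_nonneg (sub_nonneg.2 hx.1) (hpos (j + 1) x hx)
      simpa using this
    | succ p ih =>
      intro j x hx
      set u : ℝ → ℝ := fun x => (x - a) * g (j + 1) x - (p + 1) * g j x with hu
      have hd : ∀ y ∈ Ico a r, HasDerivAt u (g (j + 1) y + (y - a) * g (j + 2) y - (p + 1) * g (j + 1) y) y := by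
        intro y hy
        have h1 := ((hasDerivAt_id y).sub_const a).mul (hg (j + 1) y hy)
        have h2 := (hg j y hy).const_mul ((p : ℝ) + 1)
        exact (h1.sub h2).congr_deriv (by simp)
      have hm : MonotoneOn u (Ico a r) := by
        refine monotoneOn_of_deriv_nonneg (convex_Ico a r)
          (fun y hy => (hd y hy).continuousAt.continuousWithinAt)
          (fun y hy => (hd y (interior_subset hy)).differentiableAt.differentiableWithinAt)
          fun y hy => ?_
        have hy' := interior_subset hy
        rw [(hd y hy').deriv]
        linarith [ih (j + 1) y hy']
      have := hm ⟨le_refl a, hx.1.trans_lt hx.2⟩ hx hx.1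
      simp only [hu, sub_self, h0, mul_zero] at this
      push_cast
      linarith
  refine le_antisymm ?_ (hpos 0 t ht)
  by_contra! hlt
  obtain ⟨p, hp⟩ := exists_nat_gt ((t - a) * g 1 t / g 0 t)
  rw [div_lt_iff₀ hlt] at hp
  linarith [key p 0 t ht]

variable {h : ℝ → ℝ} {l r : ℝ}

theorem contDiffOn_Ioo_of_absolutelyMonotoneOn (hh : AbsolutelyMonotoneOn h (Ico l r)) :
    ContDiffOn ℝ ∞ h (Ioo l r) := hh.contDiffOn.mono Ioo_subset_Ico_self

theorem iteratedDeriv_nonneg_of_absolutelyMonotoneOn (hh : AbsolutelyMonotoneOn h (Ico l r))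
    (m : ℕ) {x : ℝ} (hx : x ∈ Ioo l r) : 0 ≤ iteratedDeriv m h x := by
  have hu : UniqueDiffOn ℝ (Ico l r) := uniqueDiffOn_Ico l r
  rw [← iteratedDerivWithin_eq_iteratedDeriv hu
    (((contDiffOn_Ioo_of_absolutelyMonotoneOn hh).contDiffAt (Ioo_mem_nhds hx.1 hx.2)).of_le
      (natCast_le_smooth m)) (Ioo_subset_Ico_self hx)]
  exact hh.iteratedDerivWithin_nonneg hu m (Ioo_subset_Ico_self hx)

/-- A derivative of an absolutely monotone function that vanishes at an interior point vanishes
identically. -/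
theorem iteratedDeriv_eq_zero_of_absolutelyMonotoneOn (hh : AbsolutelyMonotoneOn h (Ico l r))
    {m : ℕ} {ξ : ℝ} (hξ : ξ ∈ Ioo l r) (h0 : iteratedDeriv m h ξ = 0) :
    ∀ x ∈ Ioo l r, iteratedDeriv m h x = 0 := by
  have hs := contDiffOn_Ioo_of_absolutelyMonotoneOn hh
  have hnn := fun m x (hx : x ∈ Ioo l r) => iteratedDeriv_nonneg_of_absolutelyMonotoneOn hh m hx
  have hmono : MonotoneOn (iteratedDeriv m h) (Ioo l r) := by
    refine monotoneOn_of_deriv_nonneg (convex_Ioo l r)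
      (contDiffOn_iteratedDeriv hs m).continuousOn
      (fun y hy => (hasDerivAt_iteratedDeriv hs m
        (interior_subset hy)).differentiableAt.differentiableWithinAt) fun y hy => ?_
    rw [(hasDerivAt_iteratedDeriv hs m (interior_subset hy)).deriv]
    exact hnn _ _ (interior_subset hy)
  -- A nonnegative nondecreasing function vanishing at `ξ` vanishes to its left, with all its
  -- derivatives. Any point there can start the propagation to the right.
  have hleft : ∀ x ∈ Ioo l ξ, iteratedDeriv m h x = 0 := fun x hx =>
    le_antisymm (h0 ▸ hmono ⟨hx.1, hx.2.trans hξ.2⟩ hξ hx.2.le) (hnn m x ⟨hx.1, hx.2.trans hξ.2⟩)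
  have hleft' : ∀ j, ∀ x ∈ Ioo l ξ, iteratedDeriv (m + j) h x = 0 := by
    intro j
    induction j with
    | zero => exact hleft
    | succ j ih =>
      intro x hx
      rw [← add_assoc, iteratedDeriv_succ]
      have : iteratedDeriv (m + j) h =ᶠ[nhds x] fun _ => 0 := by
        filter_upwards [Ioo_mem_nhds hx.1 hx.2] with y hy using ih y hy
      rw [this.deriv_eq]
      simp
  intro x hx
  rcases lt_or_ge x ξ with hlt | hge
  · exact hleft x ⟨hx.1, hlt⟩
  · set a := (l + ξ) / 2 with ha
    have hla : l < a := by rw [ha]; linarith [hξ.1]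
    have haξ : a < ξ := by rw [ha]; linarith [hξ.1]
    have hsub : ∀ y ∈ Ico a r, y ∈ Ioo l r := fun y hy => ⟨hla.trans_le hy.1, hy.2⟩
    exact eq_zero_of_nonneg_derivatives (a := a) (r := r) (g := fun j => iteratedDeriv (m + j) h)
      (fun j y hy => hasDerivAt_iteratedDeriv hs (m + j) (hsub y hy))
      (fun j y hy => hnn _ _ (hsub y hy)) (fun j => hleft' j a ⟨hla, haξ⟩)
      ⟨haξ.le.trans hge, hx.2⟩

end AbsolutelyMonotone

end DesignEnergy

/-! ### The functional of the Levenshtein quadrature. -/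

namespace DesignEnergy

open Polynomial

section Functional

variable {n : ℕ} (hn : 2 ≤ n)

/-- The functional `f ↦ f₀ - f(1) / N`. -/
noncomputable def levenshteinFunctional (N : ℕ) : ℝ[X] →ₗ[ℝ] ℝ :=
  zerothCoeff n hn - (N : ℝ)⁻¹ • leval (1 : ℝ)

theorem levenshteinFunctional_apply (N : ℕ) (f : ℝ[X]) :
    levenshteinFunctional hn N f = zerothCoeff n hn f - f.eval 1 / N := by
  simp [levenshteinFunctional, leval_apply]
  ring

theorem zerothCoeff_sq_pos {q : ℝ[X]} (hq : q ≠ 0) : 0 < zerothCoeff n hn (q ^ 2) :=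
  zerothCoeff_pos hn (pow_ne_zero 2 hq) fun t _ => by
    rw [eval_pow]
    positivity

/-- Cauchy-Schwarz for `q` and the kernel `K` reproducing the value at `1`, whose squared norm is
`K(1) = D`. -/
theorem eval_one_sq_le (k : ℕ) {q : ℝ[X]} (hd : q.natDegree ≤ k + 1) :
    q.eval 1 ^ 2 ≤ dgsBound n (2 * (k + 1)) * zerothCoeff n hn (q ^ 2) := by
  set K := parityKernel n (k + 1) + parityKernel n k with hK
  set D : ℝ := ((dgsBound n (2 * (k + 1)) : ℕ) : ℝ) with hD
  have hDpos : 0 < D := by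
    rw [hD, dgsBound_even hn]
    exact add_pos (homDim_pos hn _) (homDim_pos hn _)
  have hK1 : K.eval 1 = D := by
    rw [hK, eval_add, parityKernel_eval_one hn, parityKernel_eval_one hn, hD, dgsBound_even hn]
  have hKd : K.natDegree ≤ k + 1 := natDegree_add_le_of_degree_le
    (parityKernel_natDegree_le hn _) ((parityKernel_natDegree_le hn _).trans (Nat.le_succ k))
  have h1 : zerothCoeff n hn (K * q) = q.eval 1 := zerothCoeff_kernel_mul hn k hd
  have h2 : zerothCoeff n hn (K * K) = D := (zerothCoeff_kernel_mul hn k hKd).trans hK1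
  have h3 : 0 ≤ zerothCoeff n hn ((D • q - q.eval 1 • K) ^ 2) := by
    by_cases h0 : D • q - q.eval 1 • K = 0
    · simp [h0]
    · exact (zerothCoeff_sq_pos hn h0).le
  have e : (D • q - q.eval 1 • K) ^ 2 =
      (D ^ 2) • q ^ 2 - (2 * D * q.eval 1) • (K * q) + (q.eval 1 ^ 2) • (K * K) := by
    simp only [smul_eq_C_mul, C_mul, C_pow, map_ofNat]
    ring
  rw [e, map_add, map_sub, map_smul, map_smul, map_smul, h1, h2] at h3
  simp only [smul_eq_mul] at h3
  refine le_of_mul_le_mul_left ?_ hDpos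
  linarith

theorem isPositiveUpTo_levenshteinFunctional {N k : ℕ} (hk : 1 ≤ k)
    (hN : dgsBound n (2 * k) < N) : IsPositiveUpTo k (levenshteinFunctional hn N) := by
  obtain ⟨k, rfl⟩ : ∃ m, k = m + 1 := ⟨k - 1, by omega⟩
  have hN' : (dgsBound n (2 * (k + 1)) : ℝ) < N := by exact_mod_cast hN
  have hN0 : (0 : ℝ) < N := (Nat.cast_nonneg _).trans_lt hN'
  constructor
  · intro q hq hd
    have h1 := eval_one_sq_le hn k hd
    have h2 := zerothCoeff_sq_pos hn hq
    rw [levenshteinFunctional_apply, eval_pow, sub_pos, div_lt_iff₀ hN0]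
    calc q.eval 1 ^ 2 ≤ _ := h1
      _ < N * zerothCoeff n hn (q ^ 2) := mul_lt_mul_of_pos_right hN' h2
      _ = _ := mul_comm _ _
  · intro q hq _
    have h0 : (1 - X ^ 2 : ℝ[X]) ≠ 0 := by
      intro h
      have := congrArg (eval 0) h
      simp at this
    have hpos : 0 < zerothCoeff n hn ((1 - X ^ 2) * q ^ 2) := by
      refine zerothCoeff_pos hn (mul_ne_zero h0 (pow_ne_zero 2 hq)) fun t ht => ?_
      rw [eval_mul, eval_pow]
      refine mul_nonneg ?_ (sq_nonneg _)
      simp only [eval_sub, eval_one, eval_pow, eval_X]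
      nlinarith [ht.1, ht.2]
    rw [levenshteinFunctional_apply]
    simpa using hpos

theorem isLevenshteinQuadrature_iff {N k : ℕ} {β γ : Fin (k + 1) → ℝ} :
    IsLevenshteinQuadrature n hn N k β γ ↔
      IsRadauQuadrature k (levenshteinFunctional hn N) β γ ∧ (∀ i, β i < 1) ∧ ∀ i, 0 < γ i := by
  constructor
  · rintro ⟨h1, h2, h3, h4, h5⟩
    refine ⟨⟨h1, h2, fun f hf => ?_⟩, h3, h4⟩
    rw [levenshteinFunctional_apply, ← gegenbauerCoeff_zero, h5 f hf]
    ring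
  · rintro ⟨⟨h1, h2, h3⟩, h4, h5⟩
    refine ⟨h1, h2, h4, h5, fun f hf => ?_⟩
    rw [← h3 f hf, levenshteinFunctional_apply, gegenbauerCoeff_zero]
    ring

theorem existsUnique_isLevenshteinQuadrature {N k : ℕ} (hk : 1 ≤ k)
    (hN : dgsBound n (2 * k) < N) :
    ∃! q : (Fin (k + 1) → ℝ) × (Fin (k + 1) → ℝ), IsLevenshteinQuadrature n hn N k q.1 q.2 := by
  have hp := isPositiveUpTo_levenshteinFunctional hn hk hN
  obtain ⟨β, γ, hq, h1⟩ := hp.exists_quadrature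
  refine ⟨(β, γ), (isLevenshteinQuadrature_iff hn).2 ⟨hq, h1, hq.weight_pos hp⟩, ?_⟩
  rintro ⟨β', γ'⟩ hq'
  obtain ⟨h1, h2⟩ := ((isLevenshteinQuadrature_iff hn).1 hq').1.unique hp hq
  exact Prod.ext h1 h2

end Functional

/-! ### Inner products in designs. -/

section Designs

variable {n k N : ℕ} {S : Finset (EuclideanSpace ℝ (Fin n))}

theorem IsDesign.inner_mem_Ico {τ : ℕ} (hS : IsDesign n τ S) {x y : EuclideanSpace ℝ (Fin n)}
    (hx : x ∈ S) (hy : y ∈ S) (hxy : x ≠ y) : inner ℝ x y ∈ Set.Ico (-1 : ℝ) 1 := by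
  have h := abs_real_inner_le_norm x y
  rw [hS.norm_eq_one x hx, hS.norm_eq_one y hy, mul_one] at h
  exact ⟨(abs_le.1 h).1, (inner_lt_one_iff_real_of_norm_eq_one (hS.norm_eq_one x hx)
    (hS.norm_eq_one y hy)).2 hxy⟩

open Classical in
-- Removing the point `y` itself subtracts `f(1)` from the design identity; this is where the
-- functional comes from.
theorem IsDesign.sum_erase_eval_inner (hn : 2 ≤ n) {τ : ℕ} (hS : IsDesign n τ S)
    {y : EuclideanSpace ℝ (Fin n)} (hy : y ∈ S) {f : ℝ[X]} (hf : f.natDegree ≤ τ) :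
    ∑ x ∈ S.erase y, f.eval (inner ℝ x y) = S.card * levenshteinFunctional hn S.card f := by
  have h := hS.sum_eval_inner hn (hS.norm_eq_one y hy) hf
  rw [← Finset.add_sum_erase S _ hy, real_inner_self_eq_norm_sq, hS.norm_eq_one y hy,
    one_pow] at h
  have hc : (S.card : ℝ) ≠ 0 := by
    have := hS.nonempty.card_pos
    positivity
  rw [levenshteinFunctional_apply, mul_sub, mul_div_cancel₀ _ hc]
  linarith

/-- Below the odd bound, inner products of designs stay away from `-1`, uniformly. -/
theorem exists_neg_one_lt_forall_le_inner (hn : 2 ≤ n) (hN : N < dgsBound n (2 * k + 1)) :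
    ∃ c : ℝ, -1 < c ∧ ∀ S : Finset (EuclideanSpace ℝ (Fin n)), IsDesign n (2 * k) S → S.card = N →
      ∀ x ∈ S, ∀ y ∈ S, x ≠ y → c ≤ inner ℝ x y := by
  classical
  set R := homDim n k with hR
  have hRpos : 0 < R := homDim_pos hn k
  have hN' : (N : ℝ) < 2 * R := by
    rw [hR, ← dgsBound_odd hn]
    exact_mod_cast hN
  set W := parityKernel n k with hW
  have hW2 : (W ^ 2).natDegree ≤ 2 * k :=
    natDegree_pow_le.trans (Nat.mul_le_mul_left 2 (parityKernel_natDegree_le hn k))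
  -- The left side is the total of `W ^ 2` over the points other than a given one. At `-1` a single
  -- term would be `R ^ 2`, which exceeds it because `N < 2R`.
  have hev : ∀ᶠ s in nhds (-1 : ℝ), N * R - R ^ 2 < (W ^ 2).eval s := by
    refine (W ^ 2).continuous.continuousAt.eventually_const_lt ?_
    change N * R - R ^ 2 < (W ^ 2).eval (-1)
    rw [eval_pow, hW, parityKernel_eval_neg_one hn, mul_pow, ← pow_mul, mul_comm k 2, pow_mul]
    norm_num
    rw [← hR]
    nlinarith
  obtain ⟨ε, hε, hball⟩ := Metric.eventually_nhds_iff.1 hev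
  refine ⟨-1 + ε, by linarith, fun S hS hcard x hx y hy hxy => ?_⟩
  by_contra! hlt
  have hI := hS.inner_mem_Ico hx hy hxy
  have h1 := hball (y := inner ℝ x y) (by
    rw [Real.dist_eq, abs_lt]
    constructor <;> linarith [hI.1])
  have h2 := hS.sum_erase_eval_inner hn hy hW2
  have h3 : (W ^ 2).eval (inner ℝ x y) ≤ ∑ z ∈ S.erase y, (W ^ 2).eval (inner ℝ z y) :=
    Finset.single_le_sum (f := fun z => (W ^ 2).eval (inner ℝ z y))
      (fun z _ => by rw [eval_pow]; positivity) (Finset.mem_erase.2 ⟨hxy, hx⟩)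
  have hN0 : (N : ℝ) ≠ 0 := by
    rw [← hcard]
    have := hS.nonempty.card_pos
    positivity
  rw [h2, hcard, levenshteinFunctional_apply, hW, zerothCoeff_parityKernel_sq hn, eval_pow,
    eval_pow, parityKernel_eval_one hn, mul_sub, mul_div_cancel₀ _ hN0] at h3
  rw [eval_pow] at h1
  linarith

/-- Every design has an inner product smaller than the least free node of the quadrature. -/
theorem IsDesign.exists_inner_lt (hn : 2 ≤ n) (hk : 1 ≤ k) {β γ : Fin (k + 1) → ℝ}
    (hS : IsDesign n (2 * k) S) (hq : IsLevenshteinQuadrature n hn S.card k β γ) :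
    ∃ x ∈ S, ∃ y ∈ S, x ≠ y ∧ inner ℝ x y < β (Fin.succ ⟨0, hk⟩) := by
  classical
  by_contra! hcon
  obtain ⟨hr, -, hγ⟩ := (isLevenshteinQuadrature_iff hn).1 hq
  set i₀ : Fin k := ⟨0, hk⟩ with hi₀
  obtain ⟨y, hy⟩ := hS.nonempty
  set P : ℝ[X] := ∏ i ∈ Finset.univ.erase i₀, (X - C (β i.succ)) with hP
  have hPd : P.natDegree = k - 1 := by
    rw [hP, natDegree_prod_of_monic _ _ fun i _ => monic_X_sub_C _]
    simp
  have hβ0 : ∀ i : Fin k, -1 < β i.succ := fun i => by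
    rw [← hr.node_zero]
    exact hr.strictMono (Fin.succ_pos i)
  -- `f` vanishes at all nodes and is nonnegative on `[β_1, 1)`, so if no inner product were below
  -- `β_1`, all would be zeros of `f`, hence of `g`. But the quadrature of `g` is `γ_0 g(-1) > 0`.
  set f : ℝ[X] := (1 + X) * ((X - C (β i₀.succ)) * P ^ 2) with hf
  set g : ℝ[X] := ((X - C (β i₀.succ)) * P) ^ 2 with hg
  have hfd : f.natDegree ≤ 2 * k := by
    refine natDegree_mul_le.trans ?_
    have h1 := natDegree_mul_le (p := X - C (β i₀.succ)) (q := P ^ 2)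
    have h2 := natDegree_pow_le (p := P) (n := 2)
    rw [natDegree_X_sub_C] at h1
    rw [natDegree_one_add_X]
    omega
  have hgd : g.natDegree ≤ 2 * k := by
    refine natDegree_pow_le.trans (Nat.mul_le_mul_left 2 ?_)
    have h1 := natDegree_mul_le (p := X - C (β i₀.succ)) (q := P)
    rw [natDegree_X_sub_C] at h1
    omega
  have hfac : ∀ i : Fin k, ((X - C (β i₀.succ)) * P).eval (β i.succ) = 0 := by
    intro i
    rw [hP, Finset.mul_prod_erase Finset.univ (fun i => X - C (β i.succ)) (Finset.mem_univ i₀),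
      eval_prod, Finset.prod_eq_zero (Finset.mem_univ i)]
    simp
  have hf0 : ∀ i, f.eval (β i) = 0 := by
    intro i
    refine Fin.cases ?_ (fun i => ?_) i
    · simp [hf, hr.node_zero]
    · have : f = (1 + X) * P * ((X - C (β i₀.succ)) * P) := by rw [hf]; ring
      rw [this, eval_mul, hfac, mul_zero]
  have hsf := hS.sum_erase_eval_inner hn hy hfd
  have hf1 : ∑ i, γ i * f.eval (β i) = 0 :=
    Finset.sum_eq_zero fun i _ => by rw [hf0, mul_zero]
  rw [hr.exact_on f hfd, hf1, mul_zero,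
    Finset.sum_eq_zero_iff_of_nonneg] at hsf
  · have hsg := hS.sum_erase_eval_inner hn hy hgd
    rw [Finset.sum_eq_zero] at hsg
    · rw [hr.exact_on g hgd, Fin.sum_univ_succ, Finset.sum_eq_zero (s := Finset.univ)
        (fun i _ => by rw [hg, eval_pow, hfac]; ring), add_zero] at hsg
      have hg0 : 0 < g.eval (β 0) := by
        rw [hg, eval_pow, hP, Finset.mul_prod_erase Finset.univ (fun i => X - C (β i.succ))
          (Finset.mem_univ i₀), eval_prod]
        refine sq_pos_iff.2 (Finset.prod_ne_zero_iff.2 fun i _ => ?_)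
        rw [hr.node_zero, eval_sub, eval_X, eval_C]
        linarith [hβ0 i]
      have hc : (0 : ℝ) < S.card := by
        have := hS.nonempty.card_pos
        positivity
      have := mul_pos hc (mul_pos (hγ 0) hg0)
      linarith
    · intro x hx
      have h1 := hsf x hx
      rw [Finset.mem_erase] at hx
      have h2 := hcon x hx.2 y hy hx.1
      have h3 : (1 + inner ℝ x y : ℝ) ≠ 0 := by linarith [hβ0 i₀]
      have h4 : g.eval (inner ℝ x y) * (1 + inner ℝ x y) =
          f.eval (inner ℝ x y) * (inner ℝ x y - β i₀.succ) := by
        simp [hf, hg]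
        ring
      rw [h1, zero_mul] at h4
      exact (mul_eq_zero.1 h4).resolve_right h3
  · intro x hx
    rw [Finset.mem_erase] at hx
    have h2 := hcon x hx.2 y hy hx.1
    simp only [hf, eval_mul, eval_add, eval_one, eval_X, eval_sub, eval_C, eval_pow]
    refine mul_nonneg (by linarith [hβ0 i₀]) (mul_nonneg (by linarith) (sq_nonneg _))

theorem IsDesign.codeMinInner_le {τ : ℕ} (hS : IsDesign n τ S) {x y : EuclideanSpace ℝ (Fin n)}
    (hx : x ∈ S) (hy : y ∈ S) (hxy : x ≠ y) : codeMinInner n S ≤ inner ℝ x y := by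
  refine csInf_le ⟨-1, ?_⟩ ⟨x, hx, y, hy, hxy, rfl⟩
  rintro _ ⟨x, hx, y, hy, hxy, rfl⟩
  exact (hS.inner_mem_Ico hx hy hxy).1

theorem le_codeMinInner (hS : 1 < S.card) {c : ℝ}
    (hc : ∀ x ∈ S, ∀ y ∈ S, x ≠ y → c ≤ inner ℝ x y) : c ≤ codeMinInner n S := by
  obtain ⟨x, hx, y, hy, hxy⟩ := Finset.one_lt_card.1 hS
  refine le_csInf ⟨_, x, hx, y, hy, hxy, rfl⟩ ?_
  rintro _ ⟨x, hx, y, hy, hxy, rfl⟩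
  exact hc x hx y hy hxy

theorem IsDesign.designMinInner_le {τ : ℕ} (hN : 1 < S.card) (hS : IsDesign n τ S)
    {x y : EuclideanSpace ℝ (Fin n)} (hx : x ∈ S) (hy : y ∈ S) (hxy : x ≠ y) :
    designMinInner n S.card τ ≤ inner ℝ x y := by
  refine le_trans (b := codeMinInner n S) ?_ (hS.codeMinInner_le hx hy hxy)
  refine csInf_le ⟨-1, ?_⟩ ⟨S, hS, rfl, rfl⟩
  rintro _ ⟨T, hT, hcard, rfl⟩
  exact le_codeMinInner (hcard ▸ hN) fun x hx y hy hxy => (hT.inner_mem_Ico hx hy hxy).1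

theorem neg_one_lt_designMinInner (hn : 2 ≤ n) (hN1 : 1 < N) (hN : N < dgsBound n (2 * k + 1))
    (hex : ∃ S : Finset (EuclideanSpace ℝ (Fin n)), IsDesign n (2 * k) S ∧ S.card = N) :
    -1 < designMinInner n N (2 * k) := by
  obtain ⟨c, hc, h⟩ := exists_neg_one_lt_forall_le_inner hn hN
  obtain ⟨S, hS, hcard⟩ := hex
  refine hc.trans_le (le_csInf ⟨_, S, hS, hcard, rfl⟩ ?_)
  rintro _ ⟨T, hT, hcard, rfl⟩
  exact le_codeMinInner (hcard ▸ hN1) (h T hT hcard)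

open Classical in
theorem IsDesign.sum_offDiag_eval_inner (hn : 2 ≤ n) {τ : ℕ} (hS : IsDesign n τ S) {f : ℝ[X]}
    (hf : f.natDegree ≤ τ) :
    ∑ p ∈ S.offDiag, f.eval (inner ℝ p.1 p.2) =
      S.card * (zerothCoeff n hn f * S.card - f.eval 1) := by
  have h1 : ∑ p ∈ S ×ˢ S, f.eval (inner ℝ p.1 p.2) = S.card * (S.card * zerothCoeff n hn f) := by
    rw [Finset.sum_product_right]
    rw [Finset.sum_congr rfl fun y hy => hS.sum_eval_inner hn (hS.norm_eq_one y hy) hf]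
    simp
  have h2 : ∑ p ∈ S.diag, f.eval (inner ℝ p.1 p.2) = S.card * f.eval 1 := by
    rw [Finset.sum_diag, Finset.sum_congr rfl fun y hy => by
      rw [real_inner_self_eq_norm_sq, hS.norm_eq_one y hy, one_pow]]
    simp
  rw [← Finset.diag_union_offDiag, Finset.sum_union (Finset.disjoint_diag_offDiag S), h2] at h1
  linarith

theorem dgsBound_even_pos (hn : 2 ≤ n) (hk : 1 ≤ k) : 0 < dgsBound n (2 * k) := by
  obtain ⟨k, rfl⟩ : ∃ m, k = m + 1 := ⟨k - 1, by omega⟩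
  have h : (0 : ℝ) < dgsBound n (2 * (k + 1)) := by
    rw [dgsBound_even hn]
    exact add_pos (homDim_pos hn _) (homDim_pos hn _)
  exact_mod_cast h

end Designs

end DesignEnergy

/-! ### The energy bound. -/

theorem theorem4p1 (n N k : ℕ) (hn : 2 ≤ n) (hk : 1 ≤ k)
    (hN : N ∈ Set.Ioo (DesignEnergy.dgsBound n (2 * k)) (DesignEnergy.dgsBound n (2 * k + 1)))
    (hex : ∃ C : Finset (EuclideanSpace ℝ (Fin n)),
      DesignEnergy.IsDesign n (2 * k) C ∧ C.card = N)
    (h : ℝ → ℝ) (hh : AbsolutelyMonotoneOn h (Set.Ico (-1) 1)) :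
    -- the quadrature exists and is unique
    (∃! q : (Fin (k + 1) → ℝ) × (Fin (k + 1) → ℝ),
      DesignEnergy.IsLevenshteinQuadrature n hn N k q.1 q.2) ∧
    -1 < DesignEnergy.designMinInner n N (2 * k) ∧
    ∀ β γ : Fin (k + 1) → ℝ, DesignEnergy.IsLevenshteinQuadrature n hn N k β γ →
      -- the Hermite interpolant exists and is unique
      (∃! G : Polynomial ℝ, DesignEnergy.IsHermiteInterpolant k h
        (DesignEnergy.designMinInner n N (2 * k)) β G) ∧
      ∀ G : Polynomial ℝ, DesignEnergy.IsHermiteInterpolant k h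
          (DesignEnergy.designMinInner n N (2 * k)) β G →
        (N : ℝ) * (DesignEnergy.gegenbauerCoeff n hn G 0 * N - G.eval 1)
            ≤ DesignEnergy.minEnergy n N (2 * k) h ∧
        (N : ℝ) * (DesignEnergy.gegenbauerCoeff n hn G 0 * N - G.eval 1)
            = (N : ℝ) ^ 2 * ∑ i, γ i * G.eval (β i) ∧
        (N : ℝ) ^ 2 * ∑ i, γ i * h (β i)
            ≤ (N : ℝ) ^ 2 * ∑ i, γ i * G.eval (β i) ∧
        -- the last inequality is strict, except when `h` is a polynomial of degree at most `2k`
        ((¬ ∃ p : Polynomial ℝ, p.natDegree ≤ 2 * k ∧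
            ∀ t ∈ Set.Ico (-1 : ℝ) 1, h t = p.eval t) →
          (N : ℝ) ^ 2 * ∑ i, γ i * h (β i)
            < (N : ℝ) ^ 2 * ∑ i, γ i * G.eval (β i)) := by
  open DesignEnergy in
  have hN1 : 1 < N := by have := dgsBound_even_pos hn hk; have := hN.1; omega
  have hN0 : (0 : ℝ) < N := by positivity
  have hℓ := neg_one_lt_designMinInner hn hN1 hN.2 hex
  refine ⟨existsUnique_isLevenshteinQuadrature hn hk hN.1, hℓ, fun β γ hq => ?_⟩
  set ℓ := designMinInner n N (2 * k) with hℓdef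
  have hr := ((isLevenshteinQuadrature_iff hn).1 hq).1
  have hβ : ∀ i : Fin k, ℓ < β i.succ := by
    intro i
    obtain ⟨S, hS, hcard⟩ := hex
    subst hcard
    obtain ⟨x, hx, y, hy, hxy, hlt⟩ := hS.exists_inner_lt hn hk hq
    refine (hS.designMinInner_le hN1 hx hy hxy).trans_lt (hlt.trans_le ?_)
    exact hr.strictMono.monotone (Fin.succ_le_succ_iff.2 (Fin.le_def.2 (Nat.zero_le _)))
  have hbi : Function.Injective fun i : Fin k => β i.succ :=
    hr.strictMono.injective.comp (Fin.succ_injective k)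
  have hbI : ∀ i : Fin k, β i.succ ∈ Set.Ioo (-1 : ℝ) 1 := fun i =>
    ⟨hℓ.trans (hβ i), hq.node_lt_one _⟩
  have hℓI : ℓ ∈ Set.Ico (-1 : ℝ) 1 := ⟨hℓ.le, (hβ ⟨0, hk⟩).trans (hbI _).2⟩
  constructor
  · obtain ⟨G, ⟨h1, h2, h3, h4⟩, huniq⟩ := exists_hermite_interpolant hbi (fun i => (hβ i).ne') (h ℓ)
      (fun i => h (β i.succ)) fun i => deriv h (β i.succ)
    exact ⟨G, ⟨h1, h2, h3, h4⟩, fun H hH => huniq H ⟨hH.1, hH.2, hH.3, hH.4⟩⟩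
  intro G hG
  have herr := fun t (ht : t ∈ Set.Ico (-1 : ℝ) 1) => exists_hermite_error hh.contDiffOn.continuousOn
    (contDiffOn_Ioo_of_absolutelyMonotoneOn hh) hbi hbI (fun i => (hβ i).ne') hℓI hG.natDegree_le
    hG.eval_left hG.eval_node hG.deriv_node ht
  have hfac : (0 : ℝ) < (2 * k + 1).factorial := by positivity
  have hge : ∀ t ∈ Set.Ico (-1 : ℝ) 1, ℓ ≤ t → G.eval t ≤ h t := by
    intro t ht hlt
    obtain ⟨ξ, hξ, he⟩ := herr t ht
    have h1 := iteratedDeriv_nonneg_of_absolutelyMonotoneOn hh (2 * k + 1) hξ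
    have h2 : 0 ≤ (t - ℓ) * ∏ i : Fin k, (t - β i.succ) ^ 2 :=
      mul_nonneg (sub_nonneg.2 hlt) (Finset.prod_nonneg fun i _ => sq_nonneg _)
    have h3 := he ▸ mul_nonneg h1 h2
    linarith [nonneg_of_mul_nonneg_right h3 hfac]
  -- `G` and `h` agree at the free nodes, so only the node `-1` contributes.
  have hsum : ∑ i, γ i * G.eval (β i) - ∑ i, γ i * h (β i) = γ 0 * (G.eval (-1) - h (-1)) := by
    rw [← Finset.sum_sub_distrib, Fin.sum_univ_succ, Finset.sum_eq_zero, hq.node_zero]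
    · ring
    · intro i _
      rw [hG.eval_node]
      ring
  obtain ⟨ξ, hξ, he⟩ := herr (-1) ⟨le_refl _, by norm_num⟩
  have hprod : 0 < (ℓ + 1) * ∏ i : Fin k, (-1 - β i.succ) ^ 2 := by
    refine mul_pos (by linarith) (Finset.prod_pos fun i _ => ?_)
    have := (hbI i).1
    exact sq_pos_iff.2 (by linarith)
  -- At `-1`, left of `ℓ`, the linear factor of the error is negative, so the interpolant lies above
  -- `h`.
  have he' : ((2 * k + 1).factorial : ℝ) * (G.eval (-1) - h (-1)) =
      iteratedDeriv (2 * k + 1) h ξ * ((ℓ + 1) * ∏ i : Fin k, (-1 - β i.succ) ^ 2) := by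
    linear_combination -he
  have hd := iteratedDeriv_nonneg_of_absolutelyMonotoneOn hh (2 * k + 1) hξ
  refine ⟨?_, ?_, ?_, ?_⟩
  · obtain ⟨S, hS, hcard⟩ := hex
    refine le_csInf ⟨_, S, hS, hcard, rfl⟩ ?_
    rintro _ ⟨T, hT, rfl, rfl⟩
    rw [gegenbauerCoeff_zero, ← hT.sum_offDiag_eval_inner hn hG.natDegree_le, energy]
    refine Finset.sum_le_sum fun p hp => ?_
    obtain ⟨h1, h2, h3⟩ := Finset.mem_offDiag.1 hp
    exact hge _ (hT.inner_mem_Ico h1 h2 h3) (hT.designMinInner_le hN1 h1 h2 h3)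
  · rw [hq.exact_on G hG.natDegree_le]
    field_simp
    ring
  · have h1 : 0 ≤ G.eval (-1) - h (-1) := by
      have := he' ▸ mul_nonneg hd hprod.le
      exact nonneg_of_mul_nonneg_right this hfac
    have := mul_nonneg (hq.weight_pos 0).le h1
    refine mul_le_mul_of_nonneg_left ?_ (by positivity)
    linarith
  · intro hpoly
    have hd' : 0 < iteratedDeriv (2 * k + 1) h ξ := by
      refine lt_of_le_of_ne hd fun h0 => hpoly ⟨G, hG.natDegree_le, fun t ht => ?_⟩
      obtain ⟨η, hη, he⟩ := herr t ht
      rw [iteratedDeriv_eq_zero_of_absolutelyMonotoneOn hh hξ h0.symm η hη, zero_mul] at he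
      linarith [(mul_eq_zero.1 he).resolve_left hfac.ne']
    have h1 : 0 < G.eval (-1) - h (-1) := by
      have := he' ▸ mul_pos hd' hprod
      exact pos_of_mul_pos_right this hfac.le
    have := mul_pos (hq.weight_pos 0) h1
    refine mul_lt_mul_of_pos_left ?_ (by positivity)
    linarith
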